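/- Let $N$ be a prime number and let $d\ge 1$ be an integer with $\gcd(N,d)=1$. Let $f\in S_2(\Gamma_0(N))$ be a newform, and let $g\in S_1(\Gamma_1(d))$ be a newform of conductor $d$ with nebentype $\chi_g:(\mathbf Z/d\mathbf Z)^\times\to\mathbf C^\times$ (newforms are normalized by $a_1=1$; the nebentype is defined by $g\big(\tfrac{az+b}{cz+e}\big)=\chi_g(e)(cz+e)\,g(z)$ for $\begin{pmatrix}a&b\\c&e\end{pmatrix}\in\Gamma_0(d)$). Let $g^*$ be the dual form, whose Fourier coefficients at $\infty$ are the complex conjugates of those of $g$, and put $$\langle g(z)g^*(Nz),f(z)\rangle = 8\pi^2\iint_{\Gamma_0(Nd)\backslash\mathfrak h} g(z)\,g^*(Nz)\,\overline{f(z)}\,dx\,dy .$$ Then there is a sign $\epsilon_N(f)\in\{1,-1\}$, the Atkin–Lehner eigenvalue of $f$ at $N$, such that $$\frac{1}{Nz^2}\,f\!\left(-\frac{1}{Nz}\right)=\epsilon_N(f)\,f(z)\qquad (z\in\mathfrak h),$$ and $$\overline{\langle g(z)g^*(Nz), f(z)\rangle} = \epsilon_N(f)\cdot \chi_g(N)^{-1}\cdot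 \langle g(z)g^*(Nz), f(z)\rangle .$$ -/

import Mathlib

open UpperHalfPlane CongruenceSubgroup
open scoped MatrixGroups ModularForm ComplexConjugate

noncomputable section

/-- The `n`-th Fourier coefficient at `∞` of a function on `ℍ` of period `1`:
`φ z = ∑ aₙ exp (2πinz)`. -/
def qCoeff (φ : ℍ → ℂ) (n : ℕ) : ℂ :=
  (qExpansion 1 φ).coeff n

/-- The function `z ↦ φ (e z)`, for a positive integer `e`. -/
def dilate (e : ℕ) (φ : ℍ → ℂ) : ℍ → ℂ :=
  fun z ↦ φ (ofComplex (e * z))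

/-- The dual form `φ*`: the function whose Fourier coefficients at `∞` are the complex conjugates
of those of `φ`. -/
def dualForm (φ : ℍ → ℂ) : ℍ → ℂ :=
  fun z ↦ ∑' n : ℕ, conj (qCoeff φ n) * Complex.exp (2 * Real.pi * Complex.I * n * z)

/-- The Petersson product of two functions of weight `k` at level `Γ₀(M)`,
`8 π² ∬ φ(z) conj (ψ(z)) y^(k-2) dx dy` over `Γ₀(M) \ ℍ`. As `-1 ∈ Γ₀(M)`, the translates
`γ⁻¹ 𝒟` of the standard fundamental domain `𝒟` of `SL(2, ℤ)`, where `γ` runs through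
representatives of `SL(2, ℤ) ⧸ Γ₀(M)`, form a fundamental domain of `Γ₀(M)`.
Here `UpperHalfPlane.petersson k ψ φ z = conj (ψ z) * φ z * y^k`, and the measure on `ℍ` is
`dx dy / y²`. -/
def peterssonProduct (M : ℕ) (k : ℤ) (φ ψ : ℍ → ℂ) : ℂ :=
  8 * Real.pi ^ 2 *
    ∑ᶠ c : SL(2, ℤ) ⧸ Gamma0 M, ∫ z in ModularGroup.fd, petersson k ψ φ (c.out⁻¹ • z)

/-- `φ` lies in `S_k(M, χ)`: it is a cusp form of weight `k` for `Γ₁(M)` with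
`φ ∣[k] γ = χ(γ₂₂) φ` for all `γ ∈ Γ₀(M)`. -/
def IsCuspFormWithNebentype (M : ℕ) (k : ℤ) (χ : DirichletCharacter ℂ M) (φ : ℍ → ℂ) : Prop :=
  (∃ F : CuspForm (Gamma1 M) k, ⇑F = φ) ∧
    ∀ γ ∈ Gamma0 M, φ ∣[k] γ = χ ((γ 1 1 : ℤ) : ZMod M) • φ

/-- The Hecke operator `T_p` (`U_p` when `p ∣ M`, since then `χ p = 0`) on `S_k(M, χ)`. -/
def heckeOperator (M : ℕ) (k : ℤ) (χ : DirichletCharacter ℂ M) (p : ℕ) (φ : ℍ → ℂ) : ℍ → ℂ :=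
  fun z ↦ (p : ℂ)⁻¹ * ∑ j ∈ Finset.range p, φ (ofComplex ((z + j) / p)) +
    χ (p : ZMod M) * (p : ℂ) ^ (k - 1) * dilate p φ z

/-- `φ` is a newform of weight `k`, level (conductor) exactly `M` and nebentype `χ`: an element of
`S_k(M, χ)` with `a₁ = 1`, which is an eigenvector of all the Hecke operators `T_p`, and which is
orthogonal to the old forms `ψ(e z)`, where `ψ ∈ S_k(M', χ')`, `M'` is a proper divisor of `M`,
`e` divides `M / M'` and `χ'` induces `χ`. -/
structure IsNewform (M : ℕ) (k : ℤ) (χ : DirichletCharacter ℂ M) (φ : ℍ → ℂ) : Prop where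
  isCuspForm : IsCuspFormWithNebentype M k χ φ
  normalized : qCoeff φ 1 = 1
  eigenform : ∀ p : ℕ, p.Prime → ∃ a : ℂ, heckeOperator M k χ p φ = a • φ
  new : ∀ (M' : ℕ) (hM' : M' ∣ M), M' ≠ M → ∀ e : ℕ, e * M' ∣ M →
    ∀ χ' : DirichletCharacter ℂ M', DirichletCharacter.changeLevel hM' χ' = χ →
    ∀ ψ : ℍ → ℂ, IsCuspFormWithNebentype M' k χ' ψ →
      peterssonProduct M k φ (dilate e ψ) = 0

/-- The Atkin–Lehner operator on weight two forms of level `Γ₀(N)`, the weight two action of the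
matrix `(0, -1; N, 0)`: `(W_N φ)(z) = N⁻¹ z⁻² φ(-1/(N z))`. -/
def atkinLehner (N : ℕ) (φ : ℍ → ℂ) : ℍ → ℂ :=
  fun z ↦ (N : ℂ)⁻¹ * ((z : ℂ) ^ 2)⁻¹ * φ (ofComplex (-1 / (N * z)))

end

/-! Write `I` for the integral of `conj f(z) g(z) g*(Nz) y²` over `Γ₀(Nd) \ ℍ`. Choose `N w - d y =
1`. The Atkin–Lehner matrix `W = (N, y; Nd, Nw)` normalizes `Γ₀(Nd)`. It factors through `Γ₀(N)` as
a multiple of the Fricke matrix, so `f ∣ W = ε f`, and through `Γ₀(d)`, so up to characters and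
scalars it exchanges `g(z) g*(Nz)` with `g*(z) g(Nz)`; the characters combine to `χ(N)`. The
reflection `J : z ↦ -conj z` makes the same exchange and fixes `f`, provided that `f` has real
coefficients. Hence the integrand `F` satisfies `F(Wz) = ε χ(N) conj F(Jz)`, and `I = ε χ(N) conj I`
(`cosetIntegral_petersson_mul_slash`), because integration over `Γ \ ℍ` is invariant under the
normalizer (`cosetIntegral_comp_smul`).

Two facts about `f` are needed, and neither is derived from multiplicity one. The sign: the trace of
`f ∣ W_N` to level one lies in `M₂(SL(2, ℤ)) = 0`, which says `f ∣ W_N = -U_N f`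
(`slash_fricke_eq_neg_heckeOperator`). So `f`, being a `U_N`-eigenform, is an eigenvector of the
involution `W_N`.

The real coefficients: for `p ≠ N` let `V = (p, 0; 0, 1)`. Unfolding gives `a_p ⟨f, f⟩ = (p + 1) ⟨f
∣ V, f⟩`, and a matrix of determinant `p` exchanges `f` and `f ∣ V`, so the right side is real
(`conj_eq_of_heckeOperator_eq_smul`). The eigenvalue at `N` is `±1`, and the Hecke recursion carries
reality to all coefficients. -/

open MeasureTheory
open scoped Pointwise
open Matrix.SpecialLinearGroup (mapGL)

/-! ### Hyperbolic measure and the standard fundamental domain. -/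

/-- The hyperbolic measure is absolutely continuous with respect to Lebesgue measure. -/
lemma UpperHalfPlane.volume_eq_zero_of_image_coe {s : Set ℍ}
    (hs : volume ((↑) '' s : Set ℂ) = 0) : volume s = 0 := by
  rw [volume_eq_lintegral, Measure.restrict_eq_zero.mpr hs, lintegral_zero_measure]

/-- The density `1 / y²` never vanishes. This is what later turns almost-everywhere vanishing of a
continuous function into vanishing. -/
instance UpperHalfPlane.isOpenPosMeasure : (volume : Measure ℍ).IsOpenPosMeasure where
  open_pos U hU hne h0 := by
    have hac : (volume.comap UpperHalfPlane.coe : Measure ℍ) ≪ volume := by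
      rw [volume_def]
      refine withDensity_absolutelyContinuous' ?_ (Filter.Eventually.of_forall fun z ↦ ?_)
      · refine Measurable.aemeasurable (Continuous.measurable ?_)
        refine ENNReal.continuous_coe.comp (.pow (.div₀ continuous_const ?_ ?_) _)
        · exact continuous_im.subtype_mk _
        · exact fun x ↦ NNReal.ne_iff.mp x.im_ne_zero
      · have : NNReal.mk z.im z.im_pos.le ≠ 0 := NNReal.ne_iff.mp z.im_ne_zero
        exact ENNReal.coe_ne_zero.mpr (pow_ne_zero _ (one_div_ne_zero this))
    have h1 := hac h0
    rw [measurableEmbedding_coe.comap_apply] at h1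
    exact ((isOpenEmbedding_coe.isOpenMap U hU).measure_ne_zero volume (hne.image _)) h1

lemma Complex.volume_re_eq (c : ℝ) : volume {z : ℂ | z.re = c} = 0 := by
  have h : {z : ℂ | z.re = c} = Complex.measurableEquivRealProd ⁻¹' ({c} ×ˢ Set.univ) := by
    ext z; simp [Complex.measurableEquivRealProd]
  rw [h, Complex.volume_preserving_equiv_real_prod.measure_preimage_equiv]
  simp [Measure.volume_eq_prod]

/-- The boundary of the standard fundamental domain is a null set. -/
lemma ModularGroup.volume_fd_diff_fdo : volume (fd \ fdo) = 0 := by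
  apply volume_eq_zero_of_image_coe
  refine measure_mono_null (t := Metric.sphere 0 1 ∪ ({z : ℂ | z.re = 1 / 2} ∪
    {z : ℂ | z.re = -(1 / 2)})) ?_ ?_
  · rintro _ ⟨z, ⟨⟨h1, h2⟩, h3⟩, rfl⟩
    simp only [fdo, Set.mem_ofPred_eq, not_and_or, not_lt] at h3
    rcases h3 with h3 | h3
    · left
      have : Complex.normSq z = 1 := le_antisymm h3 h1
      rw [Complex.normSq_eq_norm_sq] at this
      simpa using (pow_eq_one_iff_of_nonneg (norm_nonneg _) two_ne_zero).mp this
    · right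
      exact (eq_or_eq_neg_of_abs_eq (le_antisymm h2 h3))
  · simp [Measure.addHaar_sphere, Complex.volume_re_eq, -one_div]

/-- The standard fundamental domain has finite volume. -/
lemma ModularGroup.volume_fd_lt_top : volume fd < ⊤ := by
  rw [volume_eq_lintegral]
  -- On `fd` one has `4 y² ≥ 3`, so `y > 1/2`; the integral of `y⁻²` over the half strip is finite.
  have hsub : ((↑) '' fd : Set ℂ) ⊆
      Complex.measurableEquivRealProd ⁻¹' (Set.Icc (-(1 / 2)) (1 / 2) ×ˢ Set.Ioi (1 / 2)) := by
    rintro _ ⟨z, hz, rfl⟩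
    have h1 := three_le_four_mul_im_sq_of_mem_fd hz
    have h2 := z.im_pos
    have h3 := abs_le.mp hz.2
    refine ⟨⟨h3.1, h3.2⟩, ?_⟩
    change 1 / 2 < z.im
    nlinarith
  have hint : ∫⁻ y in Set.Ioi (1 / 2 : ℝ), ((((1 / ‖y‖₊) ^ 2 : NNReal)) : ENNReal) < ⊤ := by
    have h := integrableOn_Ioi_rpow_of_lt (a := -2) (by norm_num) (c := 1 / 2) (by norm_num)
    refine lt_of_eq_of_lt (setLIntegral_congr_fun measurableSet_Ioi fun y hy ↦ ?_) h.2
    have hy' : (0 : ℝ) < y := lt_trans (by norm_num) hy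
    rw [← ofReal_norm, Real.norm_of_nonneg (by positivity), ENNReal.ofReal]
    congr 1
    ext
    simp [Real.rpow_neg hy'.le, abs_of_pos hy', Real.toNNReal_of_nonneg, hy'.le]
  refine (lintegral_mono_set hsub).trans_lt ?_
  have hm := (Complex.volume_preserving_equiv_real_prod.setLIntegral_comp_preimage_emb
    Complex.measurableEquivRealProd.measurableEmbedding
    (fun p : ℝ × ℝ ↦ ((((1 / ‖p.2‖₊) ^ 2 : NNReal)) : ENNReal))
    (Set.Icc (-(1 / 2)) (1 / 2) ×ˢ Set.Ioi (1 / 2)))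
  refine lt_of_eq_of_lt hm ?_
  rw [Measure.volume_eq_prod, ← Measure.prod_restrict, lintegral_prod _ (by fun_prop)]
  simp only [lintegral_const]
  exact ENNReal.mul_lt_top hint (by simp)

/-! ### Fundamental domains for subgroups of `SL(2, ℤ)`. -/

instance UpperHalfPlane.measurableConstSMul_PGL : MeasurableConstSMul PGL(2, ℝ) ℍ where
  measurable_const_smul g := by
    induction g using QuotientGroup.induction_on with
    | H g => exact measurable_const_smul (α := ℍ) g

instance UpperHalfPlane.smulInvariantMeasure_PGL :
    SMulInvariantMeasure PGL(2, ℝ) ℍ volume where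
  measure_preimage_smul g s hs := by
    induction g using QuotientGroup.induction_on with
    | H g => exact measure_preimage_smul volume g s

namespace ModularGroup

/-- The homomorphism `SL(2, ℤ) → PGL(2, ℝ)`. -/
noncomputable def toPGL : SL(2, ℤ) →* PGL(2, ℝ) :=
  Matrix.ProjGenLinGroup.mk.comp (mapGL ℝ)

/-- The reason for working in `PGL(2, ℝ)`: `γ` and `-γ` act alike on `ℍ`, so translates of a domain
can be almost disjoint only after they are identified. -/
lemma toPGL_neg (γ : SL(2, ℤ)) : toPGL (-γ) = toPGL γ := by
  rw [← neg_one_mul, map_mul, mul_eq_right]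
  refine (QuotientGroup.eq_one_iff _).mpr ?_
  rw [Matrix.GeneralLinearGroup.center_eq_range_scalar]
  exact ⟨-1, by ext i j; fin_cases i <;> fin_cases j <;> simp [mapGL]⟩

instance : Countable SL(2, ℤ) :=
  have : Countable (Matrix (Fin 2) (Fin 2) ℤ) := inferInstanceAs (Countable (Fin 2 → Fin 2 → ℤ))
  Subtype.countable

/-- The points lying on the boundary of some translate of the standard fundamental domain. -/
def fdBoundary : Set ℍ := ⋃ γ : SL(2, ℤ), γ • (fd \ fdo)

lemma volume_fdBoundary : volume fdBoundary = 0 := by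
  refine measure_iUnion_null fun γ ↦ ?_
  exact (measure_smul volume (mapGL ℝ γ) (fd \ fdo)).trans volume_fd_diff_fdo

/-- Off the boundary `γ • z` is interior to `fd`, and only `±1` can move an interior point to a
point of `fd`. -/
lemma eq_or_eq_neg_of_smul_mem_fd {z : ℍ} (hz : z ∉ fdBoundary) {γ δ : SL(2, ℤ)}
    (hγ : γ • z ∈ fd) (hδ : δ • z ∈ fd) : δ = γ ∨ δ = -γ := by
  have h1 : γ • z ∈ fdo := by
    by_contra h
    exact hz (Set.mem_iUnion.mpr ⟨γ⁻¹, Set.mem_inv_smul_set_iff.mpr ⟨hγ, h⟩⟩)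
  have h2 : (δ * γ⁻¹) • γ • z ∈ fd := by rwa [smul_smul, inv_mul_cancel_right]
  rcases eq_one_or_neg_one_of_mem_fdo_mem_fd h1 h2 with h | h
  · exact .inl (by rwa [mul_inv_eq_one] at h)
  · exact .inr (by rw [mul_inv_eq_iff_eq_mul] at h; simpa using h)

section CosetDomain

variable (Γ : Subgroup SL(2, ℤ))

/-- The union of the translates `γ⁻¹ 𝒟`, over representatives `γ` of `SL(2, ℤ) ⧸ Γ`. -/
noncomputable def cosetDomain : Set ℍ := ⋃ c : SL(2, ℤ) ⧸ Γ, c.out⁻¹ • fd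

lemma aedisjoint_out_inv_smul_fd (hΓ : -1 ∈ Γ) :
    Pairwise (Function.onFun (AEDisjoint volume) fun c : SL(2, ℤ) ⧸ Γ ↦ c.out⁻¹ • fd) := by
  intro c c' hc
  refine measure_mono_null (fun z hz ↦ ?_) volume_fdBoundary
  by_contra hzN
  apply hc
  rw [← c.out_eq', ← c'.out_eq', QuotientGroup.eq]
  rcases eq_or_eq_neg_of_smul_mem_fd hzN (Set.mem_inv_smul_set_iff.mp hz.1)
    (Set.mem_inv_smul_set_iff.mp hz.2) with h | h
  · rw [h, inv_mul_cancel]; exact one_mem _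
  · rwa [h, mul_neg, inv_mul_cancel]

lemma nullMeasurableSet_smul_fd (γ : SL(2, ℤ)) :
    NullMeasurableSet (γ • fd) (volume : Measure ℍ) :=
  (isClosed_fd.smul (mapGL ℝ γ)).measurableSet.nullMeasurableSet

instance : Countable (Γ.map toPGL) := ((Set.to_countable (Γ : Set SL(2, ℤ))).image toPGL).to_subtype

/-- If `Γ` contains `-1`, then `cosetDomain Γ` is a fundamental domain for the image of `Γ`
in `PGL(2, ℝ)`. -/
lemma isFundamentalDomain_cosetDomain (hΓ : -1 ∈ Γ) :
    IsFundamentalDomain (Γ.map toPGL) (cosetDomain Γ) (volume : Measure ℍ) where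
  nullMeasurableSet :=
    have : Countable (SL(2, ℤ) ⧸ Γ) := QuotientGroup.mk_surjective.countable
    .iUnion fun c ↦ nullMeasurableSet_smul_fd _
  ae_covers := .of_forall fun z ↦ by
    obtain ⟨γ, hγ⟩ := exists_smul_mem_fd z
    set c : SL(2, ℤ) ⧸ Γ := QuotientGroup.mk γ
    have h : c.out⁻¹ * γ ∈ Γ := by
      rw [← QuotientGroup.eq, QuotientGroup.out_eq']
    refine ⟨⟨toPGL (c.out⁻¹ * γ), _, h, rfl⟩, Set.mem_iUnion.mpr ⟨c, ?_⟩⟩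
    rw [Set.mem_inv_smul_set_iff]
    change c.out • (c.out⁻¹ * γ) • z ∈ fd
    rwa [smul_smul, mul_inv_cancel_left]
  aedisjoint := by
    rintro ⟨_, δ, hδ, rfl⟩ ⟨_, δ', hδ', rfl⟩ hne
    refine measure_mono_null (fun z hz ↦ ?_) volume_fdBoundary
    by_contra hzN
    apply hne
    -- A point of two translates gives `c.out * δ⁻¹ = ± c'.out * δ'⁻¹`. Reading this modulo `Γ`
    -- forces `c = c'`, and then `δ = ± δ'`.
    have key : ∀ ε ∈ Γ, z ∈ toPGL ε • cosetDomain Γ →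
        ∃ c : SL(2, ℤ) ⧸ Γ, (c.out * ε⁻¹) • z ∈ fd := by
      rintro ε - ⟨w, hw, rfl⟩
      obtain ⟨c, hc⟩ := Set.mem_iUnion.mp hw
      refine ⟨c, ?_⟩
      change (c.out * ε⁻¹) • ε • w ∈ fd
      rw [smul_smul, inv_mul_cancel_right]
      exact Set.mem_inv_smul_set_iff.mp hc
    obtain ⟨c, hc⟩ := key δ hδ hz.1
    obtain ⟨c', hc'⟩ := key δ' hδ' hz.2
    have h := eq_or_eq_neg_of_smul_mem_fd hzN hc hc'
    have hcc : c = c' := by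
      rw [← c.out_eq', ← c'.out_eq', QuotientGroup.eq]
      rcases h with h | h
      · rw [mul_inv_eq_iff_eq_mul] at h
        rw [h]
        simpa [mul_assoc] using mul_mem (inv_mem hδ) hδ'
      · rw [mul_inv_eq_iff_eq_mul] at h
        rw [h]
        have := mul_mem hΓ (mul_mem (inv_mem hδ) hδ')
        simpa [mul_assoc] using this
    subst hcc
    apply Subtype.ext
    change toPGL δ = toPGL δ'
    rcases h with h | h
    · rw [mul_right_inj, inv_inj] at h
      rw [h]
    · rw [← mul_neg, mul_right_inj] at h
      rw [← inv_inj, ← map_inv, ← map_inv, h, toPGL_neg]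

end CosetDomain

/-! ### Integration over `Γ \ ℍ` and its invariance. -/

/-- The integral of a `Γ`-invariant function over `Γ \ ℍ`, as a sum over `SL(2, ℤ) ⧸ Γ`. -/
noncomputable def cosetIntegral (Γ : Subgroup SL(2, ℤ)) (F : ℍ → ℂ) : ℂ :=
  ∑ᶠ c : SL(2, ℤ) ⧸ Γ, ∫ z in fd, F (c.out⁻¹ • z)

/-- Bounded continuous functions on `ℍ`, without bundling. -/
def IsBoundedContinuous (F : ℍ → ℂ) : Prop := Continuous F ∧ ∃ C, ∀ z, ‖F z‖ ≤ C

lemma IsBoundedContinuous.comp_smul {F : ℍ → ℂ} (hF : IsBoundedContinuous F)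
    (g : GL (Fin 2) ℝ) : IsBoundedContinuous fun z ↦ F (g • z) :=
  ⟨hF.1.comp (continuous_const_smul g), hF.2.imp fun _ h _ ↦ h _⟩

lemma IsBoundedContinuous.integrableOn {F : ℍ → ℂ} (hF : IsBoundedContinuous F) {s : Set ℍ}
    (hs : volume s < ⊤) : IntegrableOn F s := by
  obtain ⟨C, hC⟩ := hF.2
  exact Measure.integrableOn_of_bounded hs.ne hF.1.aestronglyMeasurable (.of_forall hC)

lemma setIntegral_comp_smul (g : GL (Fin 2) ℝ) (s : Set ℍ) (F : ℍ → ℂ) :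
    ∫ z in s, F (g • z) = ∫ z in g • s, F z :=
  ((measurePreserving_smul g volume).setIntegral_image_emb
    (measurableEmbedding_const_smul g) F s).symm

section CosetIntegral

variable {Γ : Subgroup SL(2, ℤ)} {F : ℍ → ℂ}

lemma apply_inv_smul_eq (hF : ∀ γ ∈ Γ, ∀ z, F (γ • z) = F z) {γ δ : SL(2, ℤ)}
    (h : (γ : SL(2, ℤ) ⧸ Γ) = δ) (z : ℍ) : F (γ⁻¹ • z) = F (δ⁻¹ • z) := by
  rw [← hF _ (QuotientGroup.eq.mp h) (δ⁻¹ • z), smul_smul, mul_inv_cancel_right]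

lemma apply_out_inv_smul (hF : ∀ γ ∈ Γ, ∀ z, F (γ • z) = F z) (γ : SL(2, ℤ)) (z : ℍ) :
    F ((γ : SL(2, ℤ) ⧸ Γ).out⁻¹ • z) = F (γ⁻¹ • z) :=
  apply_inv_smul_eq hF (QuotientGroup.out_eq' _) z

lemma cosetIntegral_eq_setIntegral [Γ.FiniteIndex] (hΓ : -1 ∈ Γ) (hb : IsBoundedContinuous F) :
    cosetIntegral Γ F = ∫ z in cosetDomain Γ, F z := by
  have hvol (γ : SL(2, ℤ)) : volume (γ • fd) < ⊤ :=
    ((measure_smul volume (mapGL ℝ γ) fd).trans_lt volume_fd_lt_top)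
  have := Fintype.ofFinite (SL(2, ℤ) ⧸ Γ)
  rw [cosetDomain, integral_iUnion_ae (fun c ↦ nullMeasurableSet_smul_fd _)
    (aedisjoint_out_inv_smul_fd Γ hΓ)
    (integrableOn_finite_iUnion.mpr fun c ↦ hb.integrableOn (hvol _)),
    tsum_fintype, cosetIntegral, finsum_eq_sum_of_fintype]
  exact Finset.sum_congr rfl fun c _ ↦ setIntegral_comp_smul (mapGL ℝ c.out⁻¹) fd F

/-- `W` normalizes the image of `Γ` in `GL(2, ℝ)`. -/
def Normalizes (Γ : Subgroup SL(2, ℤ)) (W : GL (Fin 2) ℝ) : Prop :=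
  ∀ γ ∈ Γ, (∃ δ ∈ Γ, W * mapGL ℝ γ = mapGL ℝ δ * W) ∧ ∃ δ ∈ Γ, mapGL ℝ γ * W = W * mapGL ℝ δ

lemma Normalizes.mk_mem_normalizer {W : GL (Fin 2) ℝ} (hW : Normalizes Γ W) :
    Matrix.ProjGenLinGroup.mk W ∈ Subgroup.normalizer (Γ.map toPGL : Set PGL(2, ℝ)) := by
  refine Subgroup.mem_normalizer_iff.mpr fun h ↦ ⟨?_, ?_⟩
  · rintro ⟨γ, hγ, rfl⟩
    obtain ⟨δ, hδ, h⟩ := (hW γ hγ).1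
    refine ⟨δ, hδ, ?_⟩
    rw [eq_mul_inv_iff_mul_eq]
    exact congrArg Matrix.ProjGenLinGroup.mk h.symm
  · rintro ⟨γ, hγ, h'⟩
    obtain ⟨δ, hδ, h⟩ := (hW γ hγ).2
    refine ⟨δ, hδ, ?_⟩
    rw [eq_mul_inv_iff_mul_eq] at h'
    have h2 : Matrix.ProjGenLinGroup.mk W * toPGL δ = toPGL γ * Matrix.ProjGenLinGroup.mk W :=
      congrArg Matrix.ProjGenLinGroup.mk h.symm
    exact mul_left_cancel (h2.trans h')

/-- Integration over `Γ \ ℍ` is invariant under the normalizer of `Γ` in `GL(2, ℝ)`. -/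
theorem cosetIntegral_comp_smul [Γ.FiniteIndex] (hΓ : -1 ∈ Γ) (hb : IsBoundedContinuous F)
    (hF : ∀ γ ∈ Γ, ∀ z, F (γ • z) = F z) {W : GL (Fin 2) ℝ} (hW : Normalizes Γ W) :
    cosetIntegral Γ (fun z ↦ F (W • z)) = cosetIntegral Γ F := by
  rw [cosetIntegral_eq_setIntegral hΓ hb, cosetIntegral_eq_setIntegral hΓ (hb.comp_smul W),
    setIntegral_comp_smul]
  have hD := isFundamentalDomain_cosetDomain Γ hΓ
  -- Conjugation by `W` is an automorphism of the image of `Γ`, so `W` carries a fundamental domain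
  -- to another one for the same group; an invariant function has the same integral over both.
  have hWD : IsFundamentalDomain (Γ.map toPGL) (W • cosetDomain Γ) (volume : Measure ℍ) :=
    hD.image_of_equiv (MulAction.toPerm W) (measurePreserving_smul W⁻¹ _).quasiMeasurePreserving
      (Subgroup.normalizerMonoidHom (Γ.map toPGL) ⟨_, hW.mk_mem_normalizer⟩⁻¹).toEquiv
      fun g z ↦ by
        change Matrix.ProjGenLinGroup.mk W •
          ((Matrix.ProjGenLinGroup.mk W)⁻¹ * g * (Matrix.ProjGenLinGroup.mk W)⁻¹⁻¹) • z =
            g • Matrix.ProjGenLinGroup.mk W • z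
        simp only [smul_smul, mul_assoc, mul_inv_cancel_left, inv_inv]
        rw [← smul_smul]
        rfl
  refine hWD.setIntegral_eq hD ?_
  rintro ⟨_, γ, hγ, rfl⟩ z
  exact hF γ hγ z

/-- Each coset of `Γ` splits into `[Γ : Δ]` cosets of `Δ`, all contributing the same integral. It
allows passage to a normal subgroup of finite index. -/
lemma cosetIntegral_eq_nsmul {Δ : Subgroup SL(2, ℤ)} [Δ.FiniteIndex] (h : Δ ≤ Γ)
    (hF : ∀ γ ∈ Γ, ∀ z, F (γ • z) = F z) :
    cosetIntegral Δ F = Nat.card (Γ ⧸ Δ.subgroupOf Γ) * cosetIntegral Γ F := by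
  have := Subgroup.finiteIndex_of_le h
  have := Fintype.ofFinite (SL(2, ℤ) ⧸ Γ)
  have := Fintype.ofFinite (SL(2, ℤ) ⧸ Δ)
  have : Fintype (Γ ⧸ Δ.subgroupOf Γ) := Fintype.ofFinite _
  rw [cosetIntegral, cosetIntegral, finsum_eq_sum_of_fintype, finsum_eq_sum_of_fintype,
    Fintype.sum_equiv (Subgroup.quotientEquivProdOfLE h) _
      (fun p ↦ ∫ z in fd, F (p.1.out⁻¹ • z)), Fintype.sum_prod_type_right]
  · simp only [Finset.sum_const, nsmul_eq_mul, Finset.card_univ, Nat.card_eq_fintype_card]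
  · intro c
    induction c using QuotientGroup.induction_on with | H γ =>
    refine setIntegral_congr_fun isClosed_fd.measurableSet fun z _ ↦ ?_
    refine (apply_out_inv_smul (fun δ hδ ↦ hF δ (h hδ)) γ z).trans ?_
    exact (apply_out_inv_smul hF γ z).symm

/-- If `Γ` is normal then integration over `Γ \ ℍ` is invariant under `SL(2, ℤ)`. -/
lemma cosetIntegral_comp_smul_of_normal [Γ.FiniteIndex] [Γ.Normal]
    (hF : ∀ γ ∈ Γ, ∀ z, F (γ • z) = F z) (γ : SL(2, ℤ)) :
    cosetIntegral Γ (fun z ↦ F (γ • z)) = cosetIntegral Γ F := by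
  have := Fintype.ofFinite (SL(2, ℤ) ⧸ Γ)
  rw [cosetIntegral, cosetIntegral, finsum_eq_sum_of_fintype, finsum_eq_sum_of_fintype]
  -- Normality makes right multiplication by `γ⁻¹` a permutation of the cosets.
  refine Fintype.sum_equiv (Equiv.mulRight ((γ⁻¹ : SL(2, ℤ)) : SL(2, ℤ) ⧸ Γ)) _ _ fun c ↦ ?_
  refine setIntegral_congr_fun isClosed_fd.measurableSet fun z _ ↦ ?_
  have h : c * ((γ⁻¹ : SL(2, ℤ)) : SL(2, ℤ) ⧸ Γ) = ((c.out * γ⁻¹ : SL(2, ℤ)) : SL(2, ℤ) ⧸ Γ) := by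
    rw [QuotientGroup.mk_mul, QuotientGroup.out_eq']
  simp only [Equiv.coe_mulRight, h, apply_out_inv_smul hF, smul_smul, mul_inv_rev, inv_inv]

lemma cosetIntegral_const_mul [Γ.FiniteIndex] (a : ℂ) (F : ℍ → ℂ) :
    cosetIntegral Γ (fun z ↦ a * F z) = a * cosetIntegral Γ F := by
  have := Fintype.ofFinite (SL(2, ℤ) ⧸ Γ)
  simp only [cosetIntegral, finsum_eq_sum_of_fintype, Finset.mul_sum, integral_const_mul]

lemma cosetIntegral_conj [Γ.FiniteIndex] (F : ℍ → ℂ) :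
    cosetIntegral Γ (fun z ↦ conj (F z)) = conj (cosetIntegral Γ F) := by
  have := Fintype.ofFinite (SL(2, ℤ) ⧸ Γ)
  simp only [cosetIntegral, finsum_eq_sum_of_fintype, map_sum, integral_conj]

lemma cosetIntegral_sum [Γ.FiniteIndex] {ι : Type*} (s : Finset ι) (G : ι → ℍ → ℂ)
    (hG : ∀ i ∈ s, IsBoundedContinuous (G i)) :
    cosetIntegral Γ (fun z ↦ ∑ i ∈ s, G i z) = ∑ i ∈ s, cosetIntegral Γ (G i) := by
  have := Fintype.ofFinite (SL(2, ℤ) ⧸ Γ)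
  simp only [cosetIntegral, finsum_eq_sum_of_fintype]
  rw [Finset.sum_comm]
  refine Finset.sum_congr rfl fun c _ ↦ integral_finsetSum _ fun i hi ↦ ?_
  exact ((hG i hi).comp_smul (mapGL ℝ c.out⁻¹)).integrableOn volume_fd_lt_top

/-- A nonnegative `Γ`-invariant function with vanishing integral over `Γ \ ℍ` is zero. -/
lemma eq_zero_of_cosetIntegral_eq_zero [Γ.FiniteIndex] {r : ℍ → ℝ} (hr : ∀ z, 0 ≤ r z)
    (hb : IsBoundedContinuous fun z ↦ (r z : ℂ)) (hF : ∀ γ ∈ Γ, ∀ z, r (γ • z) = r z)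
    (h0 : cosetIntegral Γ (fun z ↦ (r z : ℂ)) = 0) (z : ℍ) : r z = 0 := by
  have := Fintype.ofFinite (SL(2, ℤ) ⧸ Γ)
  have hc : Continuous r := Complex.continuous_re.comp hb.1
  simp only [cosetIntegral, finsum_eq_sum_of_fintype, integral_complex_ofReal] at h0
  norm_cast at h0
  rw [Finset.sum_eq_zero_iff_of_nonneg fun c _ ↦ integral_nonneg fun _ ↦ hr _] at h0
  obtain ⟨γ, hγ⟩ := exists_smul_mem_fd z
  have h1 := h0 (QuotientGroup.mk γ) (Finset.mem_univ _)
  set c : SL(2, ℤ) ⧸ Γ := QuotientGroup.mk γ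
  have hcc : Continuous fun z ↦ r (c.out⁻¹ • z) :=
    hc.comp (continuous_const_smul (mapGL ℝ c.out⁻¹))
  have hint : IntegrableOn (fun z ↦ r (c.out⁻¹ • z)) fd :=
    ((hb.comp_smul (mapGL ℝ c.out⁻¹)).integrableOn volume_fd_lt_top).re
  rw [integral_eq_zero_iff_of_nonneg (fun _ ↦ hr _) hint] at h1
  -- Continuity upgrades almost-everywhere vanishing to the open set `fdo`, then to its closure
  -- `fd`.
  have h2 := Measure.eqOn_open_of_ae_eq (ae_restrict_of_ae_restrict_of_subset fdo_subset_fd h1)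
    isOpen_fdo hcc.continuousOn continuousOn_const
  have h3 : Set.EqOn (fun z ↦ r (c.out⁻¹ • z)) 0 fd := by
    rw [fd_eq_closure_fdo]
    exact h2.closure hcc continuous_const
  have h4 := h3 hγ
  have h5 : c.out⁻¹ * γ ∈ Γ := by rw [← QuotientGroup.eq, QuotientGroup.out_eq']
  rw [← hF _ h5, mul_smul]
  exact h4

end CosetIntegral

/-! ### Integral matrices, slash action and normalizers of `Γ₀`. -/

/-- An integral matrix with nonzero determinant, as an element of `GL(2, ℝ)`. -/
noncomputable def intGL (A : Matrix (Fin 2) (Fin 2) ℤ) (hA : A.det ≠ 0) : GL (Fin 2) ℝ :=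
  .mkOfDetNeZero (A.map (Int.castRingHom ℝ)) (by
    rw [← RingHom.mapMatrix_apply, ← RingHom.map_det]
    simpa using hA)

lemma intGL_apply (A : Matrix (Fin 2) (Fin 2) ℤ) (hA : A.det ≠ 0) (i j : Fin 2) :
    intGL A hA i j = (A i j : ℝ) := rfl

lemma intGL_mul {A B : Matrix (Fin 2) (Fin 2) ℤ} (hA : A.det ≠ 0) (hB : B.det ≠ 0) :
    intGL A hA * intGL B hB = intGL (A * B) (by rw [Matrix.det_mul]; exact mul_ne_zero hA hB) := by
  ext i j
  simp [intGL, Matrix.mul_apply]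

lemma intGL_congr {A B : Matrix (Fin 2) (Fin 2) ℤ} (hA : A.det ≠ 0) (h : A = B) :
    intGL A hA = intGL B (h ▸ hA) := by subst h; rfl

lemma mapGL_eq_intGL (γ : SL(2, ℤ)) :
    mapGL ℝ γ = intGL γ.1 (by rw [γ.2]; exact one_ne_zero) := by
  ext i j
  simp [intGL_apply]

lemma det_intGL (A : Matrix (Fin 2) (Fin 2) ℤ) (hA : A.det ≠ 0) :
    (intGL A hA).det.val = (A.det : ℝ) := by
  rw [Matrix.GeneralLinearGroup.val_det_apply]
  change (A.map (Int.castRingHom ℝ)).det = _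
  rw [← RingHom.mapMatrix_apply, ← RingHom.map_det]
  simp

lemma σ_intGL {A : Matrix (Fin 2) (Fin 2) ℤ} (hA : 0 < A.det) (z : ℂ) :
    σ (intGL A hA.ne') z = z := by
  rw [σ, if_pos]
  · rfl
  · rw [det_intGL]; exact_mod_cast hA

lemma coe_intGL_smul {A : Matrix (Fin 2) (Fin 2) ℤ} (hA : 0 < A.det) (z : ℍ) :
    ((intGL A hA.ne' • z : ℍ) : ℂ) = (A 0 0 * z + A 0 1) / (A 1 0 * z + A 1 1) := by
  rw [coe_smul, σ_intGL hA]
  simp [num, denom, intGL_apply]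

lemma slash_intGL_apply {A : Matrix (Fin 2) (Fin 2) ℤ} (hA : 0 < A.det) (k : ℤ) (φ : ℍ → ℂ)
    (z : ℍ) : (φ ∣[k] intGL A hA.ne') z =
      φ (intGL A hA.ne' • z) * (A.det : ℂ) ^ (k - 1) * (A 1 0 * z + A 1 1) ^ (-k) := by
  rw [ModularForm.slash_apply, σ_intGL hA, det_intGL, abs_of_pos (by exact_mod_cast hA)]
  simp [denom, intGL_apply]

/-- The slash action of a positive scalar matrix. -/
lemma slash_scalar {n : ℤ} (hn : 0 < n) (h : (!![n, 0; 0, n]).det ≠ 0) (k : ℤ) (φ : ℍ → ℂ) :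
    φ ∣[k] intGL !![n, 0; 0, n] h = ((n : ℂ) ^ (k - 2)) • φ := by
  have hn' : (n : ℂ) ≠ 0 := by exact_mod_cast hn.ne'
  have hd : 0 < (!![n, 0; 0, n]).det := by simpa using mul_pos hn hn
  ext z
  have hz : intGL !![n, 0; 0, n] h • z = z := by
    ext
    rw [coe_intGL_smul hd]
    simp [hn']
  rw [slash_intGL_apply hd, hz]
  simp only [Matrix.det_fin_two_of, Matrix.of_apply, Matrix.cons_val, Pi.smul_apply, smul_eq_mul]
  push_cast
  rw [sub_zero, zero_mul, zero_add, mul_zpow, mul_assoc, mul_assoc, ← zpow_add₀ hn',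
    ← zpow_add₀ hn', mul_comm]
  congr 2
  ring

lemma matrix_congr {a b c d a' b' c' d' : ℤ} (ha : a = a') (hb : b = b') (hc : c = c')
    (hd : d = d') : !![a, b; c, d] = !![a', b'; c', d'] := by
  rw [ha, hb, hc, hd]

/-- The matrix `(Qx, y; QRz, Qw)` of determinant `Q` normalizes `Γ₀(QR)`. -/
lemma normalizes_Gamma0 (Q R : ℕ) (x y z w : ℤ) (h : Q * x * w - R * y * z = 1)
    (hA : (!![Q * x, y; Q * R * z, Q * w] : Matrix (Fin 2) (Fin 2) ℤ).det ≠ 0) :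
    Normalizes (Gamma0 (Q * R)) (intGL !![Q * x, y; Q * R * z, Q * w] hA) := by
  intro γ hγ
  rw [Gamma0_mem, ZMod.intCast_zmod_eq_zero_iff_dvd] at hγ
  obtain ⟨c, hc⟩ := hγ
  have hdet := γ.2
  rw [Matrix.det_fin_two] at hdet
  set a := γ.1 0 0
  set b := γ.1 0 1
  set e := γ.1 1 1
  have hc' : γ.1 1 0 = Q * R * c := by rw [hc]; push_cast; ring
  rw [hc'] at hdet
  have hγm : γ.1 = !![a, b; Q * R * c, e] := by
    rw [← hc']; exact Matrix.eta_fin_two _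
  -- The matrix is `A γ adj(A) / Q` for `A = (Qx, y; QRz, Qw)`. Replacing `(x, y, z, w)` by `(w, -y,
  -- -z, x)` turns `A` into its adjugate and gives the conjugate in the other direction.
  have key : ∀ x y z w : ℤ, Q * x * w - R * y * z = 1 → ∃ δ : SL(2, ℤ), δ.1 =
      !![w * Q * (x * a + y * R * c) - R * z * (Q * x * b + y * e),
        -y * (x * a + y * R * c) + x * (Q * x * b + y * e);
        Q * R * (w * (z * a + w * Q * c) - z * (R * z * b + w * e)),
        -y * R * (z * a + Q * w * c) + Q * x * (R * z * b + w * e)] := by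
    intro x y z w h
    refine ⟨⟨_, ?_⟩, rfl⟩
    rw [Matrix.det_fin_two_of]
    linear_combination (Q * x * w - R * y * z) ^ 2 * hdet + (Q * x * w - R * y * z + 1) * h
  have hmem : ∀ {δ : SL(2, ℤ)} (t : ℤ), δ.1 1 0 = Q * R * t → δ ∈ Gamma0 (Q * R) := by
    intro δ t ht
    rw [Gamma0_mem, ZMod.intCast_zmod_eq_zero_iff_dvd]
    exact ⟨t, by rw [ht]; push_cast; ring⟩
  obtain ⟨δ, hδ⟩ := key x y z w h
  obtain ⟨δ', hδ'⟩ := key w (-y) (-z) x (by linarith)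
  refine ⟨⟨δ, hmem _ (by rw [hδ]; rfl), ?_⟩, ⟨δ', hmem _ (by rw [hδ']; rfl), ?_⟩⟩
  · rw [mapGL_eq_intGL, mapGL_eq_intGL, intGL_mul, intGL_mul]
    refine intGL_congr _ ?_
    rw [hγm, hδ, Matrix.mul_fin_two, Matrix.mul_fin_two]
    refine matrix_congr ?_ ?_ ?_ ?_
    · linear_combination -(Q * x * a + y * (Q * R * c)) * h
    · linear_combination -(Q * x * b + y * e) * h
    · linear_combination -(Q * R * z * a + Q * w * (Q * R * c)) * h
    · linear_combination -(Q * R * z * b + Q * w * e) * h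
  · rw [mapGL_eq_intGL, mapGL_eq_intGL, intGL_mul, intGL_mul]
    refine intGL_congr _ ?_
    rw [hγm, hδ', Matrix.mul_fin_two, Matrix.mul_fin_two]
    refine matrix_congr ?_ ?_ ?_ ?_
    · linear_combination -(a * (Q * x) + b * (Q * R * z)) * h
    · linear_combination -(a * y + b * (Q * w)) * h
    · linear_combination -(Q * R * c * (Q * x) + e * (Q * R * z)) * h
    · linear_combination -(Q * R * c * y + e * (Q * w)) * h

/-! ### Boundedness of Petersson integrands. -/

/-- A bound for functions of weight `k` that holds for cusp forms: `|φ(z)|² y ^ k` is bounded. -/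
def PeterssonBounded (k : ℤ) (φ : ℍ → ℂ) : Prop :=
  Continuous φ ∧ ∃ C, ∀ z, ‖petersson k φ φ z‖ ≤ C

lemma PeterssonBounded.slash {k : ℤ} {φ : ℍ → ℂ} (h : PeterssonBounded k φ)
    (g : GL (Fin 2) ℝ) : PeterssonBounded k (φ ∣[k] g) := by
  refine ⟨?_, ?_⟩
  · have h1 : Continuous fun z : ℍ ↦ denom g z := by unfold denom; fun_prop
    have h2 : Continuous fun z : ℍ ↦ denom g z ^ (-k) :=
      h1.zpow₀ _ fun z ↦ .inl (denom_ne_zero g z)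
    rw [ModularForm.slash_def]
    exact (((σ g).continuous.comp (h.1.comp (continuous_const_smul g))).mul
      continuous_const).mul h2
  · obtain ⟨C, hC⟩ := h.2
    refine ⟨‖((|g.det.val| : ℝ) : ℂ) ^ (k - 2)‖ * C, fun z ↦ ?_⟩
    rw [petersson_slash, norm_mul, norm_σ]
    exact mul_le_mul_of_nonneg_left (hC _) (norm_nonneg _)

lemma norm_petersson_sq (k : ℤ) (φ ψ : ℍ → ℂ) (z : ℍ) :
    ‖petersson k φ ψ z‖ ^ 2 = ‖petersson k φ φ z‖ * ‖petersson k ψ ψ z‖ := by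
  simp only [petersson, norm_mul, Complex.norm_conj]
  ring

lemma PeterssonBounded.isBoundedContinuous {k : ℤ} {φ ψ : ℍ → ℂ} (hφ : PeterssonBounded k φ)
    (hψ : PeterssonBounded k ψ) : IsBoundedContinuous (petersson k φ ψ) := by
  refine ⟨petersson_continuous k hφ.1 hψ.1, ?_⟩
  obtain ⟨C, hC⟩ := hφ.2
  obtain ⟨D, hD⟩ := hψ.2
  refine ⟨√(C * D), fun z ↦ Real.le_sqrt_of_sq_le ?_⟩
  rw [norm_petersson_sq]
  exact mul_le_mul (hC z) (hD z) (norm_nonneg _) ((norm_nonneg _).trans (hC z))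

lemma PeterssonBounded.mul {k l : ℤ} {φ ψ : ℍ → ℂ} (hφ : PeterssonBounded k φ)
    (hψ : PeterssonBounded l ψ) : PeterssonBounded (k + l) (φ * ψ) := by
  refine ⟨hφ.1.mul hψ.1, ?_⟩
  obtain ⟨C, hC⟩ := hφ.2
  obtain ⟨D, hD⟩ := hψ.2
  refine ⟨C * D, fun z ↦ ?_⟩
  have h : petersson (k + l) (φ * ψ) (φ * ψ) z = petersson k φ φ z * petersson l ψ ψ z := by
    have hz : (z.im : ℂ) ≠ 0 := by exact_mod_cast z.im_ne_zero
    simp only [petersson, Pi.mul_apply, map_mul, zpow_add₀ hz]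
    ring
  rw [h, norm_mul]
  exact mul_le_mul (hC z) (hD z) (norm_nonneg _) ((norm_nonneg _).trans (hC z))

lemma _root_.CuspForm.peterssonBounded {k : ℤ} {Γ : Subgroup (GL (Fin 2) ℝ)} [Γ.IsArithmetic]
    (φ : CuspForm Γ k) : PeterssonBounded k φ :=
  ⟨CuspFormClass.holo φ |>.continuous, CuspFormClass.petersson_bounded_left k Γ φ φ⟩

/-! ### Hecke operators at primes not dividing the level: real eigenvalues. -/

/-- The element `(a, b; c, d)` of `SL(2, ℤ)`. -/
def mkSL (a b c d : ℤ) (h : a * d - b * c = 1) : SL(2, ℤ) :=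
  ⟨!![a, b; c, d], by rw [Matrix.det_fin_two_of, h]⟩

lemma coe_mkSL (a b c d : ℤ) (h : a * d - b * c = 1) : (mkSL a b c d h).1 = !![a, b; c, d] := rfl

lemma mem_Gamma0_iff_dvd {M : ℕ} {γ : SL(2, ℤ)} : γ ∈ Gamma0 M ↔ (M : ℤ) ∣ γ.1 1 0 := by
  rw [Gamma0_mem, ZMod.intCast_zmod_eq_zero_iff_dvd]

lemma mkSL_mem_Gamma0 {M : ℕ} {a b c d : ℤ} (h : a * d - b * c = 1) (hc : (M : ℤ) ∣ c) :
    mkSL a b c d h ∈ Gamma0 M :=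
  mem_Gamma0_iff_dvd.mpr hc

/-- The matrix `(n, 0; 0, 1)`. -/
noncomputable def diagGL (n : ℕ) (hn : n ≠ 0) : GL (Fin 2) ℝ :=
  intGL !![n, 0; 0, 1] (by simpa using hn)

/-- The matrix `(1, j; 0, n)`. -/
noncomputable def shearGL (n : ℕ) (hn : n ≠ 0) (j : ℤ) : GL (Fin 2) ℝ :=
  intGL !![1, j; 0, n] (by simpa using hn)

lemma slash_diagGL (n : ℕ) (hn : n ≠ 0) (k : ℤ) (φ : ℍ → ℂ) :
    φ ∣[k] diagGL n hn = (n : ℂ) ^ (k - 1) • dilate n φ := by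
  have hd : 0 < (!![(n : ℤ), 0; 0, 1]).det := by simpa using Nat.pos_of_ne_zero hn
  ext z
  have h := slash_intGL_apply hd k φ z
  have hz := coe_intGL_smul hd z
  simp only [Matrix.of_apply, Matrix.cons_val] at hz h
  rw [diagGL, h, ← ofComplex_apply (intGL _ _ • z), hz]
  simp [dilate, mul_comm]

lemma slash_shearGL_apply (n : ℕ) (hn : n ≠ 0) (j : ℤ) (k : ℤ) (φ : ℍ → ℂ) (z : ℍ) :
    (φ ∣[k] shearGL n hn j) z = (n : ℂ)⁻¹ * φ (ofComplex ((z + j) / n)) := by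
  have hd : 0 < (!![1, j; 0, (n : ℤ)]).det := by simpa using Nat.pos_of_ne_zero hn
  have h := slash_intGL_apply hd k φ z
  have hz := coe_intGL_smul hd z
  simp only [Matrix.of_apply, Matrix.cons_val] at hz h
  have hn' : (n : ℂ) ≠ 0 := by exact_mod_cast hn
  rw [shearGL, h, ← ofComplex_apply (intGL _ _ • z), hz]
  simp only [Matrix.det_fin_two_of]
  push_cast
  rw [mul_assoc, one_mul, mul_zero, sub_zero, zero_mul, zero_add, one_mul, ← zpow_add₀ hn',
    show k - 1 + -k = -1 by ring, zpow_neg_one, mul_comm]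

lemma heckeOperator_eq_sum_slash (M : ℕ) (k : ℤ) (χ : DirichletCharacter ℂ M) {p : ℕ}
    (hp : p ≠ 0) (φ : ℍ → ℂ) : heckeOperator M k χ p φ =
      ∑ j ∈ Finset.range p, φ ∣[k] shearGL p hp j + χ p • φ ∣[k] diagGL p hp := by
  ext z
  simp only [heckeOperator, Pi.add_apply, Finset.sum_apply, Pi.smul_apply, smul_eq_mul,
    slash_shearGL_apply, slash_diagGL, Finset.mul_sum]
  push_cast
  ring

/-- If `W = γ B` with `φ ∣ γ = φ`, then `φ ∣ W = φ ∣ B`. -/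
lemma slash_mul_of_eq {k : ℤ} {φ : ℍ → ℂ} {γ : SL(2, ℤ)} (hγ : φ ∣[k] γ = φ)
    {W B : GL (Fin 2) ℝ} (h : W = mapGL ℝ γ * B) : φ ∣[k] W = φ ∣[k] B := by
  rw [h, SlashAction.slash_mul]
  exact congrArg (· ∣[k] B) hγ

lemma petersson_comp_smul_intGL {A : Matrix (Fin 2) (Fin 2) ℤ} (hA : 0 < A.det) (φ ψ : ℍ → ℂ)
    (z : ℍ) : petersson 2 φ ψ (intGL A hA.ne' • z) =
      petersson 2 (φ ∣[(2 : ℤ)] intGL A hA.ne') (ψ ∣[(2 : ℤ)] intGL A hA.ne') z := by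
  rw [petersson_slash, σ_intGL hA]
  simp

lemma petersson_self (k : ℤ) (φ : ℍ → ℂ) (z : ℍ) :
    petersson k φ φ z = ((‖φ z‖ ^ 2 * z.im ^ k : ℝ) : ℂ) := by
  simp [petersson, Complex.conj_mul']

/-- Conjugation by `(p, 0; 0, 1)` maps `Γ₀(pN)` into `Γ₀(N)`. -/
lemma exists_diagGL_mul_mapGL {p N : ℕ} (hp : p ≠ 0) {γ : SL(2, ℤ)} (hγ : γ ∈ Gamma0 (p * N)) :
    ∃ γ' ∈ Gamma0 N, γ'.1 1 1 = γ.1 1 1 ∧ diagGL p hp * mapGL ℝ γ = mapGL ℝ γ' * diagGL p hp := by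
  obtain ⟨c, hc⟩ := mem_Gamma0_iff_dvd.mp hγ
  have hc' : γ.1 1 0 = p * (N * c) := by rw [hc]; push_cast; ring
  have hd := γ.2
  rw [Matrix.det_fin_two, hc'] at hd
  refine ⟨mkSL (γ.1 0 0) (p * γ.1 0 1) (N * c) (γ.1 1 1) (by linarith),
    mkSL_mem_Gamma0 _ (dvd_mul_right _ _), rfl, ?_⟩
  rw [mapGL_eq_intGL, mapGL_eq_intGL, diagGL, intGL_mul, intGL_mul]
  refine intGL_congr _ ?_
  have hγ1 : γ.1 = !![γ.1 0 0, γ.1 0 1; p * (N * c), γ.1 1 1] := by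
    rw [← hc']; exact Matrix.eta_fin_two _
  rw [coe_mkSL, Matrix.mul_fin_two]
  conv_lhs => rw [hγ1]
  rw [Matrix.mul_fin_two]
  apply matrix_congr <;> ring

/-- The eigenvalues of the Hecke operator `T_p`, `p ∤ N`, on weight two cusp forms of level
`Γ₀(N)` are real. -/
theorem conj_eq_of_heckeOperator_eq_smul {N p : ℕ} (hN : N ≠ 0) (hp : p.Prime)
    (hpN : p.Coprime N) {f : ℍ → ℂ} (hf : PeterssonBounded 2 f)
    (hinv : ∀ γ ∈ Gamma0 N, f ∣[(2 : ℤ)] γ = f) (hf0 : f ≠ 0) {a : ℂ}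
    (ha : heckeOperator N 2 1 p f = a • f) : conj a = a := by
  have hp0 := hp.ne_zero
  have hp0' : (0 : ℤ) < p := by exact_mod_cast hp.pos
  have : NeZero (p * N) := ⟨mul_ne_zero hp0 hN⟩
  obtain ⟨e, b, hbe⟩ : ∃ e b : ℤ, p * e - N * b = 1 := by
    obtain ⟨u, v, h⟩ := Int.isCoprime_iff_gcd_eq_one.mpr (by exact_mod_cast hpN :
      Int.gcd (p : ℤ) (N : ℤ) = 1)
    exact ⟨u, -v, by linarith⟩
  -- elements of `Γ₀(N)`
  let β : SL(2, ℤ) := mkSL 1 b N (p * e) (by linarith)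
  let δ : SL(2, ℤ) := mkSL p b N e (by linarith)
  have hβm : β ∈ Gamma0 N := mkSL_mem_Gamma0 _ dvd_rfl
  have hδm : δ ∈ Gamma0 N := mkSL_mem_Gamma0 _ dvd_rfl
  have hW0 : (!![(p : ℤ) * 1, b; p * N * 1, p * e]).det = p := by
    rw [Matrix.det_fin_two_of]; linear_combination (p : ℤ) * hbe
  have hW1 : 0 < (!![(p : ℤ) * 1, b; p * N * 1, p * e]).det := by rw [hW0]; exact hp0'
  set W := intGL !![(p : ℤ) * 1, b; p * N * 1, p * e] hW1.ne' with hWdef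
  set V := diagGL p hp0 with hV
  set fV := f ∣[(2 : ℤ)] V with hfV
  have hfWV : f ∣[(2 : ℤ)] W = fV := by
    refine slash_mul_of_eq (hinv β hβm) ?_
    rw [mapGL_eq_intGL, hV, diagGL, intGL_mul]
    refine intGL_congr _ ?_
    rw [coe_mkSL, Matrix.mul_fin_two]
    apply matrix_congr <;> ring
  have hfVW : fV ∣[(2 : ℤ)] W = f := by
    have hs : (!![(p : ℤ), 0; 0, p]).det ≠ 0 := by simpa using hp0
    have h1 : V * W = mapGL ℝ δ * intGL !![(p : ℤ), 0; 0, p] hs := by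
      rw [mapGL_eq_intGL, hV, diagGL, intGL_mul, intGL_mul]
      refine intGL_congr _ ?_
      rw [coe_mkSL, Matrix.mul_fin_two, Matrix.mul_fin_two]
      apply matrix_congr <;> ring
    rw [hfV, ← SlashAction.slash_mul, slash_mul_of_eq (hinv δ hδm) h1, slash_scalar hp0']
    simp
  -- the pairing of `f` and `f | V` is real
  set F := petersson 2 f fV with hF
  have hFW (z : ℍ) : F (W • z) = conj (F z) := by
    rw [hF, petersson_comp_smul_intGL hW1, ← hWdef, hfWV, hfVW, petersson_symm]
  have hFb : IsBoundedContinuous F := hf.isBoundedContinuous (hf.slash V)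
  have hle : Gamma0 (p * N) ≤ Gamma0 N := by
    intro γ hγ
    rw [mem_Gamma0_iff_dvd] at hγ ⊢
    exact dvd_trans (by push_cast; exact dvd_mul_left _ _) hγ
  have hfVinv : ∀ γ ∈ Gamma0 (p * N), fV ∣[(2 : ℤ)] γ = fV := by
    intro γ hγ
    obtain ⟨γ', hγ', -, h⟩ := exists_diagGL_mul_mapGL hp0 hγ
    rw [hfV, ModularForm.SL_slash, ← SlashAction.slash_mul]
    exact slash_mul_of_eq (hinv γ' hγ') h
  have hFinv : ∀ γ ∈ Gamma0 (p * N), ∀ z, F (γ • z) = F z := by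
    intro γ hγ z
    rw [hF, ← petersson_slash_SL, hinv γ (hle hγ), hfVinv γ hγ]
  have hneg : (-1 : SL(2, ℤ)) ∈ Gamma0 (p * N) := by simp [Gamma0_mem]
  have hreal : conj (cosetIntegral (Gamma0 (p * N)) F) = cosetIntegral (Gamma0 (p * N)) F := by
    rw [← cosetIntegral_conj, ← cosetIntegral_comp_smul hneg hFb hFinv
      (normalizes_Gamma0 p N 1 b 1 e (by linarith) hW1.ne')]
    exact congrArg _ (funext fun z ↦ (hFW z).symm)
  -- pass to the normal core
  set Δ := (Gamma0 (p * N)).normalCore with hΔ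
  have hΔle : Δ ≤ Gamma0 (p * N) := Subgroup.normalCore_le _
  -- Each `(1, j; 0, p)` is `V β T^j` up to `Γ₀(N)` on the left. As `β T^j` fixes `f`, every Hecke
  -- term is a translate of the single function `F`, and over a normal subgroup all translates have
  -- equal integrals.
  have hshear (j : ℤ) (z : ℍ) : petersson 2 f (f ∣[(2 : ℤ)] shearGL p hp0 j) z =
      F ((β * T ^ j) • z) := by
    have h1 : V * mapGL ℝ (β * T ^ j) = mapGL ℝ δ * shearGL p hp0 j := by
      rw [mapGL_eq_intGL, mapGL_eq_intGL, hV, diagGL, shearGL, intGL_mul, intGL_mul]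
      refine intGL_congr _ ?_
      rw [Matrix.SpecialLinearGroup.coe_mul, coe_T_zpow, coe_mkSL, coe_mkSL]
      simp only [Matrix.mul_fin_two]
      apply matrix_congr <;> ring
    have hT : T ^ j ∈ Gamma0 N := by simp [Gamma0_mem, coe_T_zpow]
    rw [hF, ← petersson_slash_SL, hinv _ (mul_mem hβm hT), hfV, ModularForm.SL_slash,
      ← SlashAction.slash_mul]
    rw [← slash_mul_of_eq (hinv δ hδm) h1]
    rfl
  have hchar : (1 : DirichletCharacter ℂ N) p = 1 :=
    MulChar.one_apply ((ZMod.isUnit_iff_coprime p N).mpr hpN)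
  have hsum : ∀ z, a * petersson 2 f f z =
      ∑ j ∈ Finset.range p, petersson 2 f (f ∣[(2 : ℤ)] shearGL p hp0 j) z + F z := by
    intro z
    have h := congrFun ha z
    rw [heckeOperator_eq_sum_slash N 2 1 hp0, hchar] at h
    simp only [Pi.add_apply, Finset.sum_apply, Pi.smul_apply, smul_eq_mul, one_mul] at h
    simp only [hF, petersson]
    rw [← Finset.sum_mul, ← Finset.mul_sum, ← add_mul, ← mul_add, h]
    ring
  have hint : a * cosetIntegral Δ (petersson 2 f f) = (p + 1) * cosetIntegral Δ F := by
    have hFΔ : ∀ γ ∈ Δ, ∀ z, F (γ • z) = F z := fun γ hγ ↦ hFinv γ (hΔle hγ)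
    have h1 (j : ℕ) : cosetIntegral Δ (fun z ↦ F ((β * T ^ (j : ℤ)) • z)) = cosetIntegral Δ F :=
      cosetIntegral_comp_smul_of_normal hFΔ _
    -- The index `j = p` stands for the diagonal term `f ∣ V`.
    have h2 : (fun z ↦ a * petersson 2 f f z) =
        fun z ↦ ∑ j ∈ Finset.range (p + 1), (if j = p then F z else F ((β * T ^ (j : ℤ)) • z)) := by
      ext z
      rw [hsum z, Finset.sum_range_succ, if_pos rfl]
      congr 1
      refine Finset.sum_congr rfl fun j hj ↦ ?_
      rw [hshear, if_neg (Finset.mem_range.mp hj).ne]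
    rw [← cosetIntegral_const_mul, h2, cosetIntegral_sum]
    · have h3 (j : ℕ) : cosetIntegral Δ (fun z ↦ if j = p then F z else F ((β * T ^ (j : ℤ)) • z)) =
          cosetIntegral Δ F := by
        split_ifs
        · rfl
        · exact h1 j
      simp only [h3, Finset.sum_const, Finset.card_range, nsmul_eq_mul]
      push_cast
      ring
    · intro j _
      split_ifs
      · exact hFb
      · exact hFb.comp_smul (mapGL ℝ (β * T ^ (j : ℤ)))
  have hpos : cosetIntegral Δ (petersson 2 f f) ≠ 0 := by
    intro h0
    apply hf0
    have h1 : petersson 2 f f = fun z ↦ ((‖f z‖ ^ 2 * z.im ^ (2 : ℤ) : ℝ) : ℂ) :=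
      funext (petersson_self 2 f)
    rw [h1] at h0
    have h2 := eq_zero_of_cosetIntegral_eq_zero (Γ := Δ) (fun z ↦ by positivity)
      (h1 ▸ hf.isBoundedContinuous hf) (fun γ hγ z ↦ ?_) h0
    · ext z
      have := h2 z
      simpa [z.im_ne_zero] using this
    · have h3 : petersson 2 f f (γ • z) = petersson 2 f f z := by
        rw [← petersson_slash_SL, hinv γ (hle (hΔle hγ))]
      rw [petersson_self, petersson_self] at h3
      exact_mod_cast h3
  have hffreal : conj (cosetIntegral Δ (petersson 2 f f)) = cosetIntegral Δ (petersson 2 f f) := by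
    rw [← cosetIntegral_conj]
    exact congrArg _ (funext fun z ↦ by rw [← petersson_symm])
  have hFreal : conj (cosetIntegral Δ F) = cosetIntegral Δ F := by
    rw [cosetIntegral_eq_nsmul hΔle hFinv, map_mul, hreal, Complex.conj_natCast]
  have := congrArg conj hint
  rw [map_mul, map_mul, map_add, map_one, Complex.conj_natCast, hffreal, hFreal, ← hint] at this
  exact mul_right_cancel₀ hpos this

/-! ### The Fricke involution and `U_N` at prime level. -/

/-- The matrix `(0, -1; N, 0)`. -/
noncomputable def frickeGL (N : ℕ) (hN : N ≠ 0) : GL (Fin 2) ℝ :=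
  intGL !![0, -1; N, 0] (by simpa using hN)

lemma atkinLehner_eq_slash {N : ℕ} (hN : N ≠ 0) (φ : ℍ → ℂ) :
    atkinLehner N φ = φ ∣[(2 : ℤ)] frickeGL N hN := by
  have hd : 0 < (!![0, -1; (N : ℤ), 0]).det := by simpa using Nat.pos_of_ne_zero hN
  have hN' : (N : ℂ) ≠ 0 := by exact_mod_cast hN
  ext z
  have h := slash_intGL_apply hd 2 φ z
  have hz := coe_intGL_smul hd z
  simp only [Matrix.of_apply, Matrix.cons_val] at hz h
  rw [frickeGL, h, ← ofComplex_apply (intGL _ _ • z), hz]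
  simp only [atkinLehner, Matrix.det_fin_two_of]
  push_cast
  have hz0 : (z : ℂ) ≠ 0 := ne_zero z
  simp only [zero_mul, zero_add, add_zero, zero_sub, neg_mul, one_mul, neg_neg]
  norm_num
  field_simp

lemma normalizes_fricke {N : ℕ} (hN : N ≠ 0) : Normalizes (Gamma0 N) (frickeGL N hN) := by
  have h := normalizes_Gamma0 N 1 0 (-1) 1 0 (by simp) (by simpa using hN)
  rw [mul_one] at h
  convert h using 1
  refine intGL_congr _ (matrix_congr ?_ ?_ ?_ ?_) <;> simp

lemma slash_fricke_fricke {N : ℕ} (hN : N ≠ 0) (φ : ℍ → ℂ) :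
    (φ ∣[(2 : ℤ)] frickeGL N hN) ∣[(2 : ℤ)] frickeGL N hN = φ := by
  have hd : (!![(N : ℤ), 0; 0, N]).det ≠ 0 := by simpa using hN
  have h : frickeGL N hN * frickeGL N hN =
      mapGL ℝ (-1 : SL(2, ℤ)) * intGL !![(N : ℤ), 0; 0, N] hd := by
    rw [mapGL_eq_intGL, frickeGL, intGL_mul, intGL_mul]
    refine intGL_congr _ ?_
    rw [Matrix.SpecialLinearGroup.coe_neg, Matrix.SpecialLinearGroup.coe_one, Matrix.one_fin_two]
    simp
  have hneg : φ ∣[(2 : ℤ)] (-1 : SL(2, ℤ)) = φ := by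
    ext z
    rw [ModularForm.SL_slash_apply, SL_neg_smul, one_smul]
    simp [denom]
  rw [← SlashAction.slash_mul, slash_mul_of_eq hneg h,
    slash_scalar (by exact_mod_cast Nat.pos_of_ne_zero hN)]
  simp

/-- The Fricke involution of a cusp form of level `Γ₀(N)` is again such a cusp form. -/
lemma exists_cuspForm_eq_slash_fricke {N : ℕ} (hN : N ≠ 0) {k : ℤ} (f : CuspForm (Gamma0 N) k) :
    ∃ F : CuspForm (Gamma0 N) k, ⇑F = ⇑f ∣[k] frickeGL N hN := by
  have hconj : ConjAct.toConjAct (frickeGL N hN)⁻¹ • ((Gamma0 N).map (mapGL ℝ)) =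
      (Gamma0 N).map (mapGL ℝ) := by
    have hW := normalizes_fricke hN
    ext g
    rw [Subgroup.mem_pointwise_smul_iff_inv_smul_mem, ← map_inv, inv_inv, ConjAct.toConjAct_smul]
    constructor
    · rintro ⟨γ, hγ, h⟩
      obtain ⟨δ, hδ, h'⟩ := (hW γ hγ).2
      refine ⟨δ, hδ, ?_⟩
      rw [h, inv_mul_cancel_right] at h'
      exact (mul_left_cancel h').symm
    · rintro ⟨γ, hγ, rfl⟩
      obtain ⟨δ, hδ, h'⟩ := (hW γ hγ).1
      exact ⟨δ, hδ, by rw [h', mul_inv_cancel_right]⟩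
  have key : ∃ F : CuspForm (ConjAct.toConjAct (frickeGL N hN)⁻¹ • ((Gamma0 N).map (mapGL ℝ))) k,
      ⇑F = ⇑f ∣[k] frickeGL N hN := ⟨CuspForm.translate f _, rfl⟩
  generalize ⇑f ∣[k] frickeGL N hN = φ at key ⊢
  rwa [hconj] at key

lemma modularForm_levelOne_weight_two_eq_zero (F : ModularForm 𝒮ℒ 2) : F = 0 :=
  rank_zero_iff_forall_zero.mp ModularForm.levelOne_weight_two_rank_zero F

/-- The trace to level one of a weight two modular form of prime level vanishes. -/
lemma add_sum_slash_S_mul_T_pow_eq_zero {N : ℕ} (hN : N.Prime) (F : CuspForm (Gamma0 N) 2) :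
    ⇑F + ∑ j ∈ Finset.range N, ⇑F ∣[(2 : ℤ)] (S * T ^ (j : ℤ)) = 0 := by
  have := Fact.mk hN
  have hz := modularForm_levelOne_weight_two_eq_zero (ModularForm.trace 𝒮ℒ F)
  replace hz := congrArg (fun G : ModularForm 𝒮ℒ 2 ↦ (⇑G : ℍ → ℂ)) hz
  simp only [ModularForm.coe_trace, FunLike.coe_zero] at hz
  let E : SL(2, ℤ) → 𝒮ℒ ⧸ ((Gamma0 N).map (mapGL ℝ)).subgroupOf 𝒮ℒ :=
    fun γ ↦ QuotientGroup.mk ⟨mapGL ℝ γ, γ, rfl⟩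
  have hE (γ δ : SL(2, ℤ)) : E γ = E δ ↔ γ⁻¹ * δ ∈ Gamma0 N := by
    rw [QuotientGroup.eq, Subgroup.mem_subgroupOf]
    change (mapGL ℝ γ)⁻¹ * mapGL ℝ δ ∈ (Gamma0 N).map (mapGL ℝ) ↔ _
    rw [← map_inv, ← map_mul,
      Subgroup.mem_map_iff_mem Matrix.SpecialLinearGroup.mapGL_injective]
  have hEf (γ : SL(2, ℤ)) : SlashInvariantForm.quotientFunc F (E γ) = ⇑F ∣[(2 : ℤ)] γ⁻¹ := by
    rw [ModularForm.SL_slash, map_inv]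
    rfl
  have hST (j : ℤ) : (S * T ^ j).1 = !![0, -1; 1, j] := by
    rw [Matrix.SpecialLinearGroup.coe_mul, coe_T_zpow, coe_S, Matrix.mul_fin_two]
    apply matrix_congr <;> ring
  have hN1 : ¬ (N : ℤ) ∣ 1 := by
    intro h
    exact hN.one_lt.not_ge (Nat.le_of_dvd one_pos (by exact_mod_cast h))
  -- The `N + 1` cosets correspond to the points of the projective line over `ℤ/N`. Inverses appear
  -- because `quotientFunc` slashes by the inverse of the representative.
  let e : Option (Fin N) → 𝒮ℒ ⧸ ((Gamma0 N).map (mapGL ℝ)).subgroupOf 𝒮ℒ :=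
    fun o ↦ o.elim (E 1) fun j ↦ E (S * T ^ (j : ℤ))⁻¹
  have hnone (j : Fin N) : E 1 ≠ E (S * T ^ (j : ℤ))⁻¹ := by
    rw [Ne, hE, inv_one, one_mul, inv_mem_iff, mem_Gamma0_iff_dvd, hST]
    exact hN1
  have hbij : Function.Bijective e := by
    constructor
    · rintro (_ | i) (_ | j) hij
      · rfl
      · exact (hnone j hij).elim
      · exact (hnone i hij.symm).elim
      · replace hij : E (S * T ^ (i : ℤ))⁻¹ = E (S * T ^ (j : ℤ))⁻¹ := hij
        rw [hE, inv_inv, mem_Gamma0_iff_dvd, Matrix.SpecialLinearGroup.coe_mul,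
          Matrix.SpecialLinearGroup.coe_inv, hST, hST, Matrix.adjugate_fin_two_of,
          Matrix.mul_fin_two] at hij
        simp only [Matrix.of_apply, Matrix.cons_val] at hij
        congr 1
        apply Fin.ext
        have h1 := (Int.modEq_iff_dvd (n := N) (a := i) (b := j)).mpr (by
          convert hij using 1; ring)
        have h2 : (i : ℕ) ≡ j [MOD N] := Int.natCast_modEq_iff.mp h1
        exact Nat.ModEq.eq_of_lt_of_lt h2 i.2 j.2
    · intro q
      induction q using QuotientGroup.induction_on with | H g =>
      obtain ⟨_, γ, rfl⟩ := g
      by_cases hγ : γ ∈ Gamma0 N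
      · exact ⟨none, (hE 1 γ).mpr (by simpa using hγ)⟩
      · rw [Gamma0_mem] at hγ
        -- The solution of `γ₀₀ + j γ₁₀ = 0` modulo the prime `N`, which puts `S T^j γ` into
        -- `Γ₀(N)`.
        let j : ZMod N := -(γ.1 0 0 : ℤ) / (γ.1 1 0 : ℤ)
        refine ⟨some ⟨j.val, j.val_lt⟩, (hE _ _).mpr ?_⟩
        rw [inv_inv, Gamma0_mem]
        have h1 : (S * T ^ (j.val : ℤ) * γ).1 1 0 = γ.1 0 0 + j.val * γ.1 1 0 := by
          rw [Matrix.SpecialLinearGroup.coe_mul, hST, Matrix.eta_fin_two γ.1, Matrix.mul_fin_two]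
          simp
        refine (congrArg (Int.cast : ℤ → ZMod N) h1).trans ?_
        push_cast
        rw [ZMod.natCast_zmod_val]
        have hγ' : ((γ.1 1 0 : ℤ) : ZMod N) ≠ 0 := hγ
        simp only [j]
        field_simp
        simp
  let := Fintype.ofFinite (𝒮ℒ ⧸ ((Gamma0 N).map (mapGL ℝ)).subgroupOf 𝒮ℒ)
  replace hz := (hbij.sum_comp (SlashInvariantForm.quotientFunc F)).trans hz
  rw [Fintype.sum_option] at hz
  rw [← hz, Finset.sum_range]
  simp only [e, Option.elim, hEf, inv_inv, inv_one, SlashAction.slash_one]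

/-- For a cusp form `f` of weight two and prime level `N`, one has `f ∣ W_N = -U_N f`. -/
theorem slash_fricke_eq_neg_heckeOperator {N : ℕ} (hN : N.Prime) (f : CuspForm (Gamma0 N) 2) :
    ⇑f ∣[(2 : ℤ)] frickeGL N hN.ne_zero = -heckeOperator N 2 1 N f := by
  obtain ⟨F, hF⟩ := exists_cuspForm_eq_slash_fricke hN.ne_zero f
  have h := add_sum_slash_S_mul_T_pow_eq_zero hN F
  have hN0 : (0 : ℤ) < N := by exact_mod_cast hN.pos
  have hchar : (1 : DirichletCharacter ℂ N) (N : ZMod N) = 0 := by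
    have := Fact.mk hN
    rw [ZMod.natCast_self]
    exact MulChar.map_nonunit _ not_isUnit_zero
  rw [heckeOperator_eq_sum_slash N 2 1 hN.ne_zero, hchar, zero_smul, add_zero, ← hF]
  rw [eq_neg_iff_add_eq_zero, ← h]
  congr 1
  refine Finset.sum_congr rfl fun j _ ↦ ?_
  have hd : (!![(N : ℤ), 0; 0, N]).det ≠ 0 := by simpa using hN.ne_zero
  -- With `F = f ∣ W_N`, hence `f = F ∣ W_N`, this turns the terms of `U_N f` into those of the
  -- trace of `F` other than `F` itself.
  have h1 : frickeGL N hN.ne_zero * shearGL N hN.ne_zero j =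
      mapGL ℝ (S * T ^ (j : ℤ)) * intGL !![(N : ℤ), 0; 0, N] hd := by
    rw [mapGL_eq_intGL, frickeGL, shearGL, intGL_mul, intGL_mul]
    refine intGL_congr _ ?_
    rw [Matrix.SpecialLinearGroup.coe_mul, coe_T_zpow, coe_S]
    simp only [Matrix.mul_fin_two]
    apply matrix_congr <;> ring
  have h2 : (⇑F ∣[(2 : ℤ)] frickeGL N hN.ne_zero) = f := by
    rw [hF, slash_fricke_fricke]
  rw [← h2, ← SlashAction.slash_mul, h1, SlashAction.slash_mul, slash_scalar hN0, sub_self,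
    zpow_zero, one_smul]
  rfl

/-! ### Fourier expansions, Hecke recursion and real coefficients. -/

/-- The `n`-th power of `q = exp (2πiz)`. -/
noncomputable def qPow (n : ℕ) (z : ℂ) : ℂ := Complex.exp (2 * Real.pi * Complex.I * n * z)

lemma qPow_eq_qParam_pow (n : ℕ) (z : ℂ) : qPow n z = Function.Periodic.qParam 1 z ^ n := by
  rw [Function.Periodic.qParam, ← Complex.exp_nat_mul, qPow]
  congr 1
  push_cast
  ring

lemma hasSum_qCoeff {k : ℤ} {Γ : Subgroup (GL (Fin 2) ℝ)} (h1 : 1 ∈ Γ.strictPeriods)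
    (φ : CuspForm Γ k) (z : ℍ) : HasSum (fun n ↦ qCoeff φ n * qPow n z) (φ z) := by
  have : Fact (IsCusp OnePoint.infty Γ) := ⟨Γ.isCusp_of_mem_strictPeriods one_pos h1⟩
  simp only [qPow_eq_qParam_pow]
  exact ModularForm.hasSum_qExpansion φ one_pos h1 z

lemma coeff_eq_qCoeff {k : ℤ} {Γ : Subgroup (GL (Fin 2) ℝ)} (h1 : 1 ∈ Γ.strictPeriods)
    (φ : CuspForm Γ k) {c : ℕ → ℂ} (hc : ∀ z : ℍ, HasSum (fun n ↦ c n * qPow n z) (φ z)) (n : ℕ) :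
    c n = qCoeff φ n := by
  simp only [qPow_eq_qParam_pow] at hc
  exact ModularFormClass.qExpansion_coeff_unique one_pos h1 hc n

lemma one_mem_strictPeriods_Gamma0 (N : ℕ) :
    1 ∈ ((Gamma0 N).map (mapGL ℝ)).strictPeriods := by
  rw [strictPeriods_Gamma0]; exact AddSubgroup.mem_zmultiples 1

lemma one_mem_strictPeriods_Gamma1 (N : ℕ) :
    1 ∈ ((Gamma1 N).map (mapGL ℝ)).strictPeriods := by
  rw [strictPeriods_Gamma1]; exact AddSubgroup.mem_zmultiples 1

/-- A geometric sum of powers of the root of unity `exp(2πi n/p)`, which equals `1` exactly when `p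
∣ n`. -/
lemma sum_qPow_div {p : ℕ} (hp : p ≠ 0) (n : ℕ) (z : ℂ) :
    (p : ℂ)⁻¹ * ∑ j ∈ Finset.range p, qPow n ((z + j) / p) =
      if p ∣ n then qPow n (z / p) else 0 := by
  have hp' : (p : ℂ) ≠ 0 := by exact_mod_cast hp
  set w := Complex.exp (2 * Real.pi * Complex.I * (n / p)) with hw
  have hterm (j : ℕ) : qPow n ((z + j) / p) = qPow n (z / p) * w ^ j := by
    rw [qPow, qPow, hw, ← Complex.exp_nat_mul, ← Complex.exp_add]
    congr 1
    field_simp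
  simp only [hterm, ← Finset.mul_sum]
  have hwp : w ^ p = 1 := by
    rw [hw, ← Complex.exp_nat_mul, Complex.exp_eq_one_iff]
    exact ⟨n, by push_cast; field_simp⟩
  have hw1 : w = 1 ↔ p ∣ n := by
    rw [hw, Complex.exp_eq_one_iff]
    constructor
    · rintro ⟨m, hm⟩
      have h1 : (n : ℂ) / p = m := by
        have h2 : (2 * Real.pi * Complex.I : ℂ) ≠ 0 := Complex.two_pi_I_ne_zero
        exact mul_left_cancel₀ h2 (by rw [hm]; ring)
      rw [div_eq_iff hp'] at h1
      have h3 : (n : ℤ) = m * p := by exact_mod_cast h1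
      exact Int.natCast_dvd_natCast.mp ⟨m, by rw [h3, mul_comm]⟩
    · rintro ⟨m, rfl⟩
      exact ⟨m, by push_cast; field_simp⟩
  split_ifs with h
  · rw [hw1.mpr h]
    simp [hp', mul_comm]
  · have h1 : (∑ j ∈ Finset.range p, w ^ j) * (w - 1) = 0 := by
      rw [geom_sum_mul, hwp, sub_self]
    have h2 : w - 1 ≠ 0 := sub_ne_zero.mpr (mt hw1.mp h)
    rw [(mul_eq_zero.mp h1).resolve_right h2, mul_zero, mul_zero]

/-- The `q`-expansion of `heckeOperator M k χ p φ`. -/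
lemma hasSum_heckeOperator {M : ℕ} {k : ℤ} {χ : DirichletCharacter ℂ M} {p : ℕ} (hp : p ≠ 0)
    {φ : ℍ → ℂ} {c : ℕ → ℂ} (hc : ∀ z : ℍ, HasSum (fun n ↦ c n * qPow n z) (φ z)) (z : ℍ) :
    HasSum (fun n ↦ (c (p * n) + χ p * (p : ℂ) ^ (k - 1) * if p ∣ n then c (n / p) else 0) *
      qPow n z) (heckeOperator M k χ p φ z) := by
  have hp' : (p : ℂ) ≠ 0 := by exact_mod_cast hp
  have hpr : (0 : ℝ) < p := by exact_mod_cast Nat.pos_of_ne_zero hp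
  have hinj : Function.Injective (p * · : ℕ → ℕ) := fun _ _ h ↦
    Nat.eq_of_mul_eq_mul_left (Nat.pos_of_ne_zero hp) h
  simp only [add_mul]
  refine HasSum.add ?_ ?_
  · have h1 (j : ℕ) : HasSum (fun n ↦ c n * qPow n ((z + j) / p))
        (φ (ofComplex ((z + j) / p))) := by
      have him : 0 < (((z : ℂ) + j) / p).im := by
        rw [Complex.div_natCast_im]
        simpa using div_pos z.im_pos hpr
      have := hc (ofComplex ((z + j) / p))
      rw [ofComplex_apply_of_im_pos him] at this ⊢
      exact this
    have h2 := (hasSum_sum fun j (_ : j ∈ Finset.range p) ↦ h1 j).mul_left (p : ℂ)⁻¹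
    simp only [← Finset.mul_sum, mul_left_comm _ (c _), sum_qPow_div hp] at h2
    rw [← hinj.hasSum_iff] at h2
    · refine HasSum.congr_fun h2 fun n ↦ ?_
      simp only [Function.comp_apply, dvd_mul_right, if_true, qPow]
      congr 2
      push_cast
      field_simp
    · intro n hn
      rw [if_neg, mul_zero]
      rintro ⟨m, rfl⟩
      exact hn ⟨m, rfl⟩
  · have him : 0 < ((p : ℂ) * z).im := by
      simpa using mul_pos hpr z.im_pos
    have h1 := (hc (ofComplex (p * z))).mul_left (χ p * (p : ℂ) ^ (k - 1))
    rw [← hinj.hasSum_iff]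
    · refine HasSum.congr_fun h1 fun n ↦ ?_
      rw [ofComplex_apply_of_im_pos him]
      simp only [Function.comp_apply, dvd_mul_right, if_true, qPow,
        Nat.mul_div_cancel_left n (Nat.pos_of_ne_zero hp), mul_assoc]
      congr 5
      push_cast
      ring
    · intro n hn
      rw [if_neg, mul_zero, zero_mul]
      rintro ⟨m, rfl⟩
      exact hn ⟨m, rfl⟩

/-- The recursion satisfied by the coefficients of a Hecke eigenform. -/
lemma qCoeff_mul_of_heckeOperator_eq_smul {M : ℕ} {k : ℤ} {χ : DirichletCharacter ℂ M} {p : ℕ}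
    (hp : p ≠ 0) {Γ : Subgroup (GL (Fin 2) ℝ)} [Γ.HasDetOne] (h1 : 1 ∈ Γ.strictPeriods)
    (φ : CuspForm Γ k) {a : ℂ} (ha : heckeOperator M k χ p φ = a • ⇑φ) (n : ℕ) :
    qCoeff φ (p * n) = a * qCoeff φ n -
      χ p * (p : ℂ) ^ (k - 1) * if p ∣ n then qCoeff φ (n / p) else 0 := by
  have h2 (z : ℍ) := hasSum_heckeOperator (M := M) (k := k) (χ := χ) hp (hasSum_qCoeff h1 φ) z
  simp only [ha] at h2
  have h3 := coeff_eq_qCoeff h1 (a • φ) h2 n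
  have h4 := coeff_eq_qCoeff h1 (a • φ) (c := fun n ↦ a * qCoeff φ n) (fun z ↦ by
    simpa [mul_assoc] using (hasSum_qCoeff h1 φ z).mul_left a) n
  rw [eq_sub_iff_add_eq, h3, h4]

/-- The dual form of a cusp form `φ` is `z ↦ conj (φ (-conj z))`. -/
lemma dualForm_eq_slash_J {k : ℤ} {Γ : Subgroup (GL (Fin 2) ℝ)} (h1 : 1 ∈ Γ.strictPeriods)
    (φ : CuspForm Γ k) : dualForm φ = ⇑φ ∣[k] J := by
  ext z
  have h2 := Complex.hasSum_conj'.mpr (hasSum_qCoeff h1 φ (J • z))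
  refine Eq.trans ?_ (h2.tsum_eq.trans ?_)
  · refine tsum_congr fun n ↦ ?_
    rw [map_mul, qPow, ← Complex.exp_conj, coe_J_smul]
    congr 2
    simp only [map_mul, map_neg, Complex.conj_ofReal, Complex.conj_I, Complex.conj_natCast,
      Complex.conj_conj, map_ofNat]
    ring
  · rw [ModularForm.slash_apply]
    simp

/-- A normalized eigenform of all Hecke operators with real eigenvalues has real coefficients. -/
lemma conj_qCoeff_of_eigenvalues {M : ℕ} {k : ℤ} {Γ : Subgroup (GL (Fin 2) ℝ)}
    [Γ.HasDetOne] (h1 : 1 ∈ Γ.strictPeriods) (φ : CuspForm Γ k) (hφ : qCoeff φ 1 = 1)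
    (ha : ∀ p : ℕ, p.Prime → ∃ a : ℂ, conj a = a ∧
      heckeOperator M k (1 : DirichletCharacter ℂ M) p φ = a • ⇑φ)
    (n : ℕ) : conj (qCoeff φ n) = qCoeff φ n := by
  induction n using Nat.strong_induction_on with | _ n ih =>
  rcases Nat.lt_or_ge n 2 with hn | hn
  · interval_cases n
    · have : Fact (IsCusp OnePoint.infty Γ) := ⟨Γ.isCusp_of_mem_strictPeriods one_pos h1⟩
      have h0 : qCoeff φ 0 = 0 := by
        exact CuspFormClass.qExpansion_coeff_zero φ one_pos h1
      rw [h0, map_zero]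
    · rw [hφ, map_one]
  -- For `n = p m` the recursion involves only the coefficients at `m` and `m / p`, both smaller
  -- than `n`.
  · set p := n.minFac with hp
    have hpp : p.Prime := Nat.minFac_prime (by omega)
    obtain ⟨m, hm⟩ := n.minFac_dvd
    rw [← hp] at hm
    have hm0 : 0 < m := Nat.pos_of_ne_zero (by rintro rfl; omega)
    have hmn : m < n := by rw [hm]; exact lt_mul_of_one_lt_left hm0 hpp.one_lt
    obtain ⟨a, har, ha'⟩ := ha p hpp
    rw [hm, qCoeff_mul_of_heckeOperator_eq_smul hpp.ne_zero h1 φ ha' m]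
    have hχ : conj ((1 : DirichletCharacter ℂ M) p) = (1 : DirichletCharacter ℂ M) p := by
      by_cases hu : IsUnit (p : ZMod M)
      · rw [MulChar.one_apply hu, map_one]
      · rw [MulChar.map_nonunit _ hu, map_zero]
    have h3 : conj (if p ∣ m then qCoeff φ (m / p) else 0) =
        if p ∣ m then qCoeff φ (m / p) else 0 := by
      split_ifs
      · exact ih _ ((Nat.div_le_self m p).trans_lt hmn)
      · exact map_zero _
    rw [map_sub, map_mul, map_mul, map_mul, map_zpow₀, Complex.conj_natCast, har, ih m hmn, hχ, h3]

lemma slash_J_eq_self {k : ℤ} {Γ : Subgroup (GL (Fin 2) ℝ)} (h1 : 1 ∈ Γ.strictPeriods)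
    (φ : CuspForm Γ k) (hφ : ∀ n, conj (qCoeff φ n) = qCoeff φ n) : ⇑φ ∣[k] J = φ := by
  rw [← dualForm_eq_slash_J h1]
  ext z
  simp only [dualForm, hφ]
  exact (hasSum_qCoeff h1 φ z).tsum_eq

/-! ### The reflection `J` and nebentypes. -/

lemma J_eq_intGL : J = intGL !![-1, 0; 0, 1] (by simp) := by
  ext i j
  fin_cases i <;> fin_cases j <;> simp [J, intGL_apply]

/-- Conjugation by `J = (-1, 0; 0, 1)`. -/
def conjJ (γ : SL(2, ℤ)) : SL(2, ℤ) :=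
  mkSL (γ.1 0 0) (-γ.1 0 1) (-γ.1 1 0) (γ.1 1 1) (by
    rw [neg_mul_neg, ← Matrix.det_fin_two, γ.2])

lemma conjJ_mem_Gamma0 {M : ℕ} {γ : SL(2, ℤ)} (hγ : γ ∈ Gamma0 M) : conjJ γ ∈ Gamma0 M :=
  mkSL_mem_Gamma0 _ ((mem_Gamma0_iff_dvd.mp hγ).neg_right)

lemma J_mul_mapGL (γ : SL(2, ℤ)) : J * mapGL ℝ γ = mapGL ℝ (conjJ γ) * J := by
  rw [mapGL_eq_intGL, mapGL_eq_intGL, J_eq_intGL, intGL_mul, intGL_mul]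
  refine intGL_congr _ ?_
  rw [conjJ, coe_mkSL, Matrix.mul_fin_two]
  conv_lhs => rw [Matrix.eta_fin_two γ.1]
  rw [Matrix.mul_fin_two]
  apply matrix_congr <;> ring

lemma mapGL_mul_J (γ : SL(2, ℤ)) : mapGL ℝ γ * J = J * mapGL ℝ (conjJ γ) := by
  have hJ : J * J = 1 := by rw [← sq, J_sq]
  rw [← mul_right_inj J, ← mul_assoc, J_mul_mapGL, mul_assoc, hJ, ← mul_assoc, hJ, mul_one, one_mul]

lemma normalizes_J (M : ℕ) : Normalizes (Gamma0 M) J := fun γ hγ ↦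
  ⟨⟨_, conjJ_mem_Gamma0 hγ, J_mul_mapGL γ⟩, ⟨_, conjJ_mem_Gamma0 hγ, mapGL_mul_J γ⟩⟩

lemma diagGL_mul_J (n : ℕ) (hn : n ≠ 0) : diagGL n hn * J = J * diagGL n hn := by
  rw [J_eq_intGL, diagGL, intGL_mul, intGL_mul]
  refine intGL_congr _ ?_
  rw [Matrix.mul_fin_two, Matrix.mul_fin_two]
  apply matrix_congr <;> ring

/-- The function `φ ∣ J` has the complex conjugate nebentype. -/
lemma slash_J_slash {M : ℕ} {k : ℤ} {χ : DirichletCharacter ℂ M} {φ : ℍ → ℂ}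
    (hφ : ∀ γ ∈ Gamma0 M, φ ∣[k] γ = χ ((γ 1 1 : ℤ) : ZMod M) • φ) {γ : SL(2, ℤ)}
    (hγ : γ ∈ Gamma0 M) :
    (φ ∣[k] J) ∣[k] γ = conj (χ ((γ.1 1 1 : ℤ) : ZMod M)) • (φ ∣[k] J) := by
  rw [ModularForm.SL_slash, ← SlashAction.slash_mul]
  change φ ∣[k] (J * mapGL ℝ γ) = _
  rw [J_mul_mapGL, SlashAction.slash_mul]
  refine (congrArg (· ∣[k] J) (hφ _ (conjJ_mem_Gamma0 hγ))).trans ?_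
  rw [ModularForm.smul_slash, sigma_J]
  rfl

lemma mul_conj_of_isUnit {M : ℕ} [NeZero M] (χ : DirichletCharacter ℂ M) {u : ZMod M}
    (hu : IsUnit u) : χ u * conj (χ u) = 1 := by
  obtain ⟨v, rfl⟩ := hu
  rw [Complex.mul_conj', χ.unit_norm_eq_one]
  simp

lemma isUnit_entry_of_mem_Gamma0 {M : ℕ} {γ : SL(2, ℤ)} (hγ : γ ∈ Gamma0 M) :
    IsUnit ((γ.1 1 1 : ℤ) : ZMod M) := by
  have h := congrArg (Int.cast : ℤ → ZMod M) ((Matrix.det_fin_two γ.1).symm.trans γ.2)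
  have h0 : ((γ.1 1 0 : ℤ) : ZMod M) = 0 := hγ
  push_cast at h
  rw [h0, mul_zero, sub_zero] at h
  exact IsUnit.of_mul_eq_one_right _ h

/-- The factor `σ B` is there because matrices of negative determinant act conjugate-linearly. -/
lemma slash_mapGL_mul_of_eq_smul {k : ℤ} {φ : ℍ → ℂ} {γ : SL(2, ℤ)} {u : ℂ}
    (hγ : φ ∣[k] γ = u • φ) {W B : GL (Fin 2) ℝ} (h : W = mapGL ℝ γ * B) :
    φ ∣[k] W = σ B u • φ ∣[k] B := by
  rw [h, SlashAction.slash_mul, ← ModularForm.smul_slash]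
  exact congrArg (· ∣[k] B) hγ

/-! ### The Atkin–Lehner relation and the theorem. -/

/-- The Atkin–Lehner relation for the integral of `conj f(z) g(z) g*(Nz) y²` over
`Γ₀(Nd) \ ℍ`. -/
theorem cosetIntegral_petersson_mul_slash {N d : ℕ} [NeZero d] (hN : N ≠ 0) (hNd : N.Coprime d)
    {χ : DirichletCharacter ℂ d} {f g : ℍ → ℂ} (hf : PeterssonBounded 2 f)
    (hg : PeterssonBounded 1 g) (hfinv : ∀ γ ∈ Gamma0 N, f ∣[(2 : ℤ)] γ = f)
    (hginv : ∀ γ ∈ Gamma0 d, g ∣[(1 : ℤ)] γ = χ ((γ 1 1 : ℤ) : ZMod d) • g)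
    (hfJ : f ∣[(2 : ℤ)] J = f) {ε : ℂ} (hε : conj ε = ε)
    (hfε : f ∣[(2 : ℤ)] frickeGL N hN = ε • f) :
    cosetIntegral (Gamma0 (N * d))
        (petersson 2 f (g * (g ∣[(1 : ℤ)] J) ∣[(1 : ℤ)] diagGL N hN)) =
      ε * χ (N : ZMod d) * conj (cosetIntegral (Gamma0 (N * d))
        (petersson 2 f (g * (g ∣[(1 : ℤ)] J) ∣[(1 : ℤ)] diagGL N hN))) := by
  have : NeZero (N * d) := ⟨mul_ne_zero hN (NeZero.ne d)⟩
  have hN0 : (0 : ℤ) < N := by exact_mod_cast Nat.pos_of_ne_zero hN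
  have hNC : (N : ℂ) ≠ 0 := by exact_mod_cast hN
  obtain ⟨w, y, hwy⟩ : ∃ w y : ℤ, N * w - d * y = 1 := by
    obtain ⟨u, v, h⟩ := Int.isCoprime_iff_gcd_eq_one.mpr (by exact_mod_cast hNd :
      Int.gcd (N : ℤ) (d : ℤ) = 1)
    exact ⟨u, -v, by linarith⟩
  set V := diagGL N hN with hV
  set gs := g ∣[(1 : ℤ)] J with hgs
  set h : ℍ → ℂ := g * gs ∣[(1 : ℤ)] V with hh
  set h' : ℍ → ℂ := gs * g ∣[(1 : ℤ)] V with hh'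
  set F := petersson 2 f h with hF
  have hFb : IsBoundedContinuous F := hf.isBoundedContinuous (hg.mul ((hg.slash J).slash V))
  have hneg : (-1 : SL(2, ℤ)) ∈ Gamma0 (N * d) := by simp [Gamma0_mem]
  have hleN : Gamma0 (N * d) ≤ Gamma0 N := fun γ hγ ↦ mem_Gamma0_iff_dvd.mpr
    (dvd_trans (by push_cast; exact dvd_mul_right _ _) (mem_Gamma0_iff_dvd.mp hγ))
  have hled : Gamma0 (N * d) ≤ Gamma0 d := fun γ hγ ↦ mem_Gamma0_iff_dvd.mpr
    (dvd_trans (by push_cast; exact dvd_mul_left _ _) (mem_Gamma0_iff_dvd.mp hγ))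
  have hhinv : ∀ γ ∈ Gamma0 (N * d), h ∣[(2 : ℤ)] γ = h := by
    intro γ hγ
    obtain ⟨γ', hγ', hγγ', hγV⟩ := exists_diagGL_mul_mapGL hN hγ
    have h1 : (gs ∣[(1 : ℤ)] V) ∣[(1 : ℤ)] γ =
        conj (χ ((γ.1 1 1 : ℤ) : ZMod d)) • gs ∣[(1 : ℤ)] V := by
      rw [ModularForm.SL_slash, ← SlashAction.slash_mul, ← hγγ']
      have h2 := slash_mapGL_mul_of_eq_smul (slash_J_slash hginv hγ') hγV
      refine h2.trans ?_
      rw [diagGL, σ_intGL (by simpa using Nat.pos_of_ne_zero hN)]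
      rfl
    have h2 := ModularForm.mul_slash_SL2 1 1 γ g (gs ∣[(1 : ℤ)] V)
    refine h2.trans ?_
    rw [h1, hginv γ (hled hγ), smul_mul_smul_comm]
    rw [mul_conj_of_isUnit χ (isUnit_entry_of_mem_Gamma0 (hled hγ)), one_smul]
  have hFinv : ∀ γ ∈ Gamma0 (N * d), ∀ z, F (γ • z) = F z := by
    intro γ hγ z
    rw [hF, ← petersson_slash_SL, hfinv γ (hleN hγ), hhinv γ hγ]
  -- the reflection `z ↦ -conj z`
  have hhJ : h ∣[(2 : ℤ)] J = h' := by
    have h1 := ModularForm.mul_slash 1 1 J g (gs ∣[(1 : ℤ)] V)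
    have h2 : (gs ∣[(1 : ℤ)] V) ∣[(1 : ℤ)] J = g ∣[(1 : ℤ)] V := by
      rw [← SlashAction.slash_mul, diagGL_mul_J, hgs, ← SlashAction.slash_mul, ← mul_assoc,
        ← sq, J_sq, one_mul]
    refine h1.trans ?_
    rw [h2, det_J]
    simp [hh', hgs]
  have hFJ (z : ℍ) : conj (F (J • z)) = petersson 2 f h' z := by
    have h1 := petersson_slash 2 f h J z
    rw [hfJ, hhJ, sigma_J] at h1
    rw [h1]
    simp [hF]
  -- the Atkin–Lehner matrix at `N`
  have hW0 : (!![(N : ℤ) * 1, y; N * d * 1, N * w]).det = N := by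
    rw [Matrix.det_fin_two_of]; linear_combination (N : ℤ) * hwy
  have hW1 : 0 < (!![(N : ℤ) * 1, y; N * d * 1, N * w]).det := by rw [hW0]; exact hN0
  set W := intGL !![(N : ℤ) * 1, y; N * d * 1, N * w] hW1.ne' with hW
  have hfW : f ∣[(2 : ℤ)] W = ε • f := by
    rw [← hfε]
    refine slash_mul_of_eq (hfinv (mkSL (-y) 1 (-(N * w)) d (by linarith))
      (mkSL_mem_Gamma0 _ ((dvd_mul_right _ _).neg_right))) ?_
    rw [mapGL_eq_intGL, frickeGL, intGL_mul]
    refine intGL_congr _ ?_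
    rw [coe_mkSL, Matrix.mul_fin_two]
    apply matrix_congr <;> ring
  have hgW : g ∣[(1 : ℤ)] W = χ ((N * w : ℤ) : ZMod d) • g ∣[(1 : ℤ)] V := by
    have h1 := slash_mapGL_mul_of_eq_smul (W := W) (B := V)
      (hginv (mkSL 1 y d (N * w) (by linarith)) (mkSL_mem_Gamma0 _ dvd_rfl)) (by
        rw [mapGL_eq_intGL, hV, diagGL, intGL_mul]
        refine intGL_congr _ ?_
        rw [coe_mkSL, Matrix.mul_fin_two]
        apply matrix_congr <;> ring)
    rw [h1, hV, diagGL, σ_intGL (by simpa using Nat.pos_of_ne_zero hN)]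
    rfl
  -- Here `V W = (N, y; d, w) · N`, and the scalar `N` acts in weight one by `N⁻¹`. This cancels the
  -- factor `det W = N` from slashing a product in `hhW`.
  have hgsW : (gs ∣[(1 : ℤ)] V) ∣[(1 : ℤ)] W = (conj (χ (w : ZMod d)) * (N : ℂ)⁻¹) • gs := by
    have hs : 0 < (!![(N : ℤ), 0; 0, N]).det := by simpa using mul_pos hN0 hN0
    have h1 := slash_mapGL_mul_of_eq_smul (W := V * W) (B := intGL !![(N : ℤ), 0; 0, N] hs.ne')
      (slash_J_slash hginv (γ := mkSL N y d w (by linarith)) (mkSL_mem_Gamma0 _ dvd_rfl)) (by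
        rw [mapGL_eq_intGL, hV, diagGL, intGL_mul, intGL_mul]
        refine intGL_congr _ ?_
        rw [coe_mkSL, Matrix.mul_fin_two, Matrix.mul_fin_two]
        apply matrix_congr <;> ring)
    rw [← SlashAction.slash_mul, h1, slash_scalar hN0, σ_intGL hs, smul_smul]
    simp [coe_mkSL, hgs]
  have hχ : χ ((N * w : ℤ) : ZMod d) * conj (χ (w : ZMod d)) = χ (N : ZMod d) := by
    have hu : IsUnit ((w : ℤ) : ZMod d) :=
      isUnit_entry_of_mem_Gamma0 (γ := mkSL N y d w (by linarith)) (mkSL_mem_Gamma0 _ dvd_rfl)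
    push_cast
    rw [map_mul, mul_assoc, mul_conj_of_isUnit χ hu, mul_one]
  have hhW : h ∣[(2 : ℤ)] W = χ (N : ZMod d) • h' := by
    have h1 := ModularForm.mul_slash 1 1 W g (gs ∣[(1 : ℤ)] V)
    refine h1.trans ?_
    rw [hgW, hgsW, hW, det_intGL, hW0, ← hχ, hh']
    ext z
    simp only [Pi.smul_apply, Pi.mul_apply, smul_eq_mul, Complex.real_smul, Int.cast_natCast,
      Nat.abs_cast, Complex.ofReal_natCast]
    field_simp
  have hFW (z : ℍ) : F (W • z) = ε * χ (N : ZMod d) * conj (F (J • z)) := by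
    rw [hF, petersson_comp_smul_intGL hW1, ← hW, hfW, hhW, ← hF, hFJ]
    simp only [petersson, Pi.smul_apply, smul_eq_mul, map_mul, hε]
    ring
  calc cosetIntegral (Gamma0 (N * d)) F
      = cosetIntegral (Gamma0 (N * d)) fun z ↦ F (W • z) :=
        (cosetIntegral_comp_smul hneg hFb hFinv
          (normalizes_Gamma0 N d 1 y 1 w (by linarith) hW1.ne')).symm
    _ = _ := by
        simp only [hFW]
        rw [cosetIntegral_const_mul, cosetIntegral_conj (fun z ↦ F (J • z)),
          cosetIntegral_comp_smul hneg hFb hFinv (normalizes_J _)]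

lemma peterssonProduct_eq (M : ℕ) (k : ℤ) (φ ψ : ℍ → ℂ) :
    peterssonProduct M k φ ψ =
      8 * Real.pi ^ 2 * cosetIntegral (Gamma0 M) (petersson k ψ φ) := rfl

end ModularGroup

open ModularGroup in
/-- The Petersson product is taken at level `Γ₀(Nd)`, the level of `g(z) g*(Nz)`. -/
theorem lemma3p2 (N d : ℕ) (hN : N.Prime) (hNd : N.Coprime d)
    (f : CuspForm (Gamma0 N) 2) (hf : IsNewform N 2 1 f)
    (g : CuspForm (Gamma1 d) 1) (χ : DirichletCharacter ℂ d) (hg : IsNewform d 1 χ g) :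
    ∃ ε : ℂ, (ε = 1 ∨ ε = -1) ∧ atkinLehner N f = ε • ⇑f ∧
      conj (peterssonProduct (N * d) 2 (fun z ↦ g z * dilate N (dualForm g) z) f) =
        ε * (χ (N : ZMod d))⁻¹ *
          peterssonProduct (N * d) 2 (fun z ↦ g z * dilate N (dualForm g) z) f := by
  have hN0 := hN.ne_zero
  have : NeZero N := ⟨hN0⟩
  have : NeZero d := ⟨by rintro rfl; exact hN.one_lt.ne' (Nat.coprime_zero_right N |>.mp hNd)⟩
  have hfinv : ∀ γ ∈ Gamma0 N, ⇑f ∣[(2 : ℤ)] γ = f := fun γ hγ ↦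
    SlashInvariantFormClass.slash_action_eq f (mapGL ℝ γ) ⟨γ, hγ, rfl⟩
  have hf0 : ⇑f ≠ 0 := by
    intro h0
    have h1 := hf.normalized
    rw [h0] at h1
    simp [qCoeff, qExpansion_zero] at h1
  -- the Atkin–Lehner eigenvalue
  obtain ⟨a, ha⟩ := hf.eigenform N hN
  have hW : ⇑f ∣[(2 : ℤ)] frickeGL N hN0 = (-a) • ⇑f := by
    rw [slash_fricke_eq_neg_heckeOperator hN f, ha]
    exact (neg_smul a ⇑f).symm
  -- `W_N` is an involution on weight two and `f ≠ 0`.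
  have haa : a * a = 1 := by
    have h1 := slash_fricke_fricke hN0 ⇑f
    rw [hW, ModularForm.smul_slash, hW, frickeGL,
      σ_intGL (by simpa using Nat.pos_of_ne_zero hN0), smul_smul, neg_mul_neg] at h1
    have h2 : (a * a - 1) • ⇑f = 0 := by rw [sub_smul, h1, one_smul, sub_self]
    exact sub_eq_zero.mp ((smul_eq_zero.mp h2).resolve_right hf0)
  have ha1 : a = 1 ∨ a = -1 := mul_self_eq_one_iff.mp haa
  have har : conj a = a := by rcases ha1 with rfl | rfl <;> simp
  -- `f` has real coefficients
  have hreal := conj_qCoeff_of_eigenvalues (M := N) (one_mem_strictPeriods_Gamma0 N) f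
    hf.normalized fun p hp ↦ by
      by_cases hpN : p = N
      · subst hpN
        exact ⟨a, har, ha⟩
      · obtain ⟨b, hb⟩ := hf.eigenform p hp
        exact ⟨b, conj_eq_of_heckeOperator_eq_smul hN0 hp ((Nat.coprime_primes hp hN).mpr hpN)
          f.peterssonBounded hfinv hf0 hb, hb⟩
  have hfJ := slash_J_eq_self (one_mem_strictPeriods_Gamma0 N) f hreal
  have hprod : (fun z ↦ g z * dilate N (dualForm g) z) =
      ⇑g * (⇑g ∣[(1 : ℤ)] J) ∣[(1 : ℤ)] diagGL N hN0 := by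
    rw [slash_diagGL, dualForm_eq_slash_J (one_mem_strictPeriods_Gamma1 d)]
    ext z
    simp
  refine ⟨-a, ?_, ?_, ?_⟩
  · rcases ha1 with rfl | rfl <;> simp
  · rw [atkinLehner_eq_slash hN0, hW]
  · have key := cosetIntegral_petersson_mul_slash hN0 hNd f.peterssonBounded g.peterssonBounded
      hfinv hg.isCuspForm.2 hfJ (ε := -a) (by rw [map_neg, har]) hW
    have hχ : χ (N : ZMod d) ≠ 0 :=
      ((ZMod.isUnit_iff_coprime N d).mpr hNd).map χ |>.ne_zero
    rw [hprod, peterssonProduct_eq]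
    set I := cosetIntegral (Gamma0 (N * d))
      (petersson 2 ⇑f (⇑g * (⇑g ∣[(1 : ℤ)] J) ∣[(1 : ℤ)] diagGL N hN0))
    rw [map_mul, map_mul, map_pow, Complex.conj_ofReal, map_ofNat]
    -- Substituting `I = ε χ(N) conj I` on the right leaves `ε² conj I`, with `ε² = a² = 1`.
    conv_rhs => rw [key]
    field_simp
    linear_combination -conj I * haa
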